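/- Let $X\in\mathbb R^{d\times n}$ be a data matrix with singular values $\sigma_1\ge\sigma_2\ge\cdots\ge\sigma_{\min(d,n)}\ge 0$, let $1\le k\le\operatorname{rank}(X)$ with $k<\min(d,n)$, and let $\eta\ge 0$. *PCA subspaces.* A $k$-dimensional PCA subspace of a matrix $A\in\mathbb R^{d\times n}$ is the span of the first $k$ vectors of an orthonormal eigenbasis of $AA^\top$ whose eigenvalues are listed in non-increasing order (it is unique unless the $k$-th and $(k+1)$-st eigenvalues coincide). *Asimov distance.* The principal angles $\theta_1,\dots,\theta_k$ of two $k$-dimensional subspaces $\mathbb P,\mathbb Q\subset\mathbb R^d$ are defined recursively by $\cos\theta_i=u_i^\top v_i=\max u^\top v$ over unit vectors $u\in\mathbb P$, $v\in\mathbb Q$ with $u_j^\top u=v_j^\top v=0$ for $j<i$. The Asimov distance $\theta(\mathbb P,\mathbb Q)$ is the largest principal angle. *Attack problem.* For a PCA subspace $\mathbb P$ of $X$, maximize $\theta(\mathbb P,\mathbb Q)$ over all $\Delta X\in\mathbb R^{d\times n}$ with $\|\Delta X\|_F\le\eta$ and all $k$-dimensional PCA subspaces $\mathbb Q$ of $X+\Delta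 X$. *Optimal value.* For every PCA subspace $\mathbb P$ of $X$ the maximum is attained. If $\eta\ge(\sigma_k-\sigma_{k+1})/\sqrt2$, it equals $\pi/2$. If $\eta<(\sigma_k-\sigma_{k+1})/\sqrt2$, it equals $$\theta^*=\tfrac12\arctan(\lambda_{\max}),\qquad \lambda_{\max}=\frac{e^2-1}{2e},\qquad e=\sqrt{\frac{1+\sqrt{1-4w}}{1-\sqrt{1-4w}}},$$ $$w=\frac{c^2-\sigma_k^2\sigma_{k+1}^2}{(\sigma_k^2-\sigma_{k+1}^2)^2},\qquad c=\frac{\sigma_k^2+\sigma_{k+1}^2}{2}-\eta^2 .$$ *Explicit maximizers.* Let $X=U\Sigma V^\top$ be any full singular value decomposition (with the $\sigma_i$ in non-increasing order on the diagonal of $\Sigma$), and let $\mathbb P$ be the span of the first $k$ columns of $U$, which is a PCA subspace of $X$. Put $\Delta X=UBV^\top$, where $B\in\mathbb R^{d\times n}$ vanishes outside the block $\begin{pmatrix}b_{k,k}&b_{k,k+1}\\ b_{k+1,k}&b_{k+1,k+1}\end{pmatrix}$. 1. Let $\eta\ge(\sigma_k-\sigma_{k+1})/\sqrt2$ and let the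 block be $\operatorname{diag}(-\eta/\sqrt2,\ \eta/\sqrt2)$. Then $\|\Delta X\|_F\le\eta$ and $\theta(\mathbb P,\mathbb Q)=\pi/2$ for some PCA subspace $\mathbb Q$ of $X+\Delta X$; if $\eta>(\sigma_k-\sigma_{k+1})/\sqrt2$, then $\theta(\mathbb P,\mathbb Q)=\pi/2$ for every such $\mathbb Q$. 2. Let $\eta<(\sigma_k-\sigma_{k+1})/\sqrt2$. With $m=\sqrt{\lambda_{\max}^2+1}+\lambda_{\max}$, $p_1=1/\sqrt{m^2+1}$, $p_2=m/\sqrt{m^2+1}$, $A=\sqrt{p_1^2\sigma_k^2+p_2^2\sigma_{k+1}^2}$, $A'=\sqrt{p_2^2\sigma_k^2+p_1^2\sigma_{k+1}^2}$ and $r=(A+A')/2$, let the block be $$\begin{pmatrix}p_1&-p_2\\ p_2&p_1\end{pmatrix}\begin{pmatrix} r p_1\sigma_k/A & r p_2\sigma_{k+1}/A\\ -r p_2\sigma_k/A' & r p_1\sigma_{k+1}/A'\end{pmatrix}-\begin{pmatrix}\sigma_k&0\\0&\sigma_{k+1}\end{pmatrix},$$ or the same matrix with both off-diagonal entries multiplied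 by $-1$. Then $\|\Delta X\|_F\le\eta$, and $\theta(\mathbb P,\mathbb Q)=\theta^*$ for every $k$-dimensional PCA subspace $\mathbb Q$ of $X+\Delta X$. -/

import Mathlib

open scoped Matrix Matrix.Norms.Frobenius

noncomputable section

/-- The singular values of the data matrix in non-increasing order, numbered from `0`: if
they are written `σ₁ ≥ σ₂ ≥ …`, then `σᵢ = singVal X (i - 1)`. -/
def singVal {d n : ℕ} (X : Matrix (Fin d) (Fin n) ℝ) (i : ℕ) : ℝ :=
  (Matrix.toEuclideanLin X).singularValues i

/-- The rectangular `d × n` diagonal matrix with diagonal entries `s 0, s 1, …`. -/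
def rectDiag (d n : ℕ) (s : ℕ → ℝ) : Matrix (Fin d) (Fin n) ℝ :=
  Matrix.of fun i j => if (i : ℕ) = (j : ℕ) then s i else 0

/-- `X = U Σ Vᵀ` is a full singular value decomposition of `X`. -/
structure IsFullSVD {d n : ℕ} (X : Matrix (Fin d) (Fin n) ℝ)
    (U : Matrix (Fin d) (Fin d) ℝ) (V : Matrix (Fin n) (Fin n) ℝ) : Prop where
  left_orthogonal : U ∈ Matrix.orthogonalGroup (Fin d) ℝ
  right_orthogonal : V ∈ Matrix.orthogonalGroup (Fin n) ℝ
  eq_mul : X = U * rectDiag d n (singVal X) * Vᵀ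

/-- The span of the first `k` columns of `U`. -/
def leadingColumnSpan {d : ℕ} (k : ℕ) (U : Matrix (Fin d) (Fin d) ℝ) :
    Submodule ℝ (EuclideanSpace ℝ (Fin d)) :=
  Submodule.span ℝ {x | ∃ j : Fin d, (j : ℕ) < k ∧ x = WithLp.toLp 2 (fun i => U i j)}

/-- `Q` is a `k`-dimensional subspace produced by PCA from the data matrix `A`, whose columns are
the data points: it is spanned by `k` leading principal components, i.e. by the first `k` vectors
of an orthonormal eigenbasis of `A Aᵀ` whose eigenvalues are listed in non-increasing order.
(Such a `Q` is unique exactly when the `k`-th and the `(k+1)`-st eigenvalue differ.) -/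
def IsPCASubspace {d n : ℕ} (k : ℕ) (A : Matrix (Fin d) (Fin n) ℝ)
    (Q : Submodule ℝ (EuclideanSpace ℝ (Fin d))) : Prop :=
  ∃ (w : OrthonormalBasis (Fin d) ℝ (EuclideanSpace ℝ (Fin d))) (μ : Fin d → ℝ),
    Antitone μ ∧ (∀ i, Matrix.toEuclideanLin (A * Aᵀ) (w i) = μ i • w i) ∧
      Q = Submodule.span ℝ (w '' {i | (i : ℕ) < k})

/-- `(x, y)` is feasible for the `i`-th step of the recursive definition of the principal angles
of `P` and `Q`, the vectors `u j`, `v j` with `j < i` having been chosen before. -/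
def PrincipalFeasible {d k : ℕ} (P Q : Submodule ℝ (EuclideanSpace ℝ (Fin d)))
    (u v : Fin k → EuclideanSpace ℝ (Fin d)) (i : Fin k)
    (x y : EuclideanSpace ℝ (Fin d)) : Prop :=
  x ∈ P ∧ y ∈ Q ∧ ‖x‖ = 1 ∧ ‖y‖ = 1 ∧ ∀ j < i, inner ℝ (u j) x = 0 ∧ inner ℝ (v j) y = 0

/-- `u 0, …, u (k-1)` and `v 0, …, v (k-1)` are principal vectors of `P` and `Q`: for every `i`,
the pair `(u i, v i)` maximizes `⟪x, y⟫` over all feasible pairs of unit vectors. The principal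
angles are `θᵢ = arccos ⟪u i, v i⟫`. -/
def IsPrincipalVectors {d k : ℕ} (P Q : Submodule ℝ (EuclideanSpace ℝ (Fin d)))
    (u v : Fin k → EuclideanSpace ℝ (Fin d)) : Prop :=
  ∀ i, PrincipalFeasible P Q u v i (u i) (v i) ∧
    ∀ x y, PrincipalFeasible P Q u v i x y → inner ℝ x y ≤ inner ℝ (u i) (v i)

/-- `θ` is the Asimov distance of the `k`-dimensional subspaces `P` and `Q`, that is, the largest
of their `k` principal angles. -/
def IsAsimovDistance {d : ℕ} (k : ℕ) (P Q : Submodule ℝ (EuclideanSpace ℝ (Fin d)))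
    (θ : ℝ) : Prop :=
  ∃ u v : Fin k → EuclideanSpace ℝ (Fin d), IsPrincipalVectors P Q u v ∧
    IsGreatest (Set.range fun i => Real.arccos (inner ℝ (u i) (v i))) θ

/-- The values of the objective of the attack problem: the Asimov distances between `P` and the
PCA subspaces of the modified data matrices `X + ΔX` with `‖ΔX‖_F ≤ η`. -/
def attackValues {d n : ℕ} (k : ℕ) (X : Matrix (Fin d) (Fin n) ℝ)
    (P : Submodule ℝ (EuclideanSpace ℝ (Fin d))) (η : ℝ) : Set ℝ :=
  {θ | ∃ (ΔX : Matrix (Fin d) (Fin n) ℝ) (Q : Submodule ℝ (EuclideanSpace ℝ (Fin d))),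
    ‖ΔX‖ ≤ η ∧ IsPCASubspace k (X + ΔX) Q ∧ IsAsimovDistance k P Q θ}

/-! In the following closed forms, `a` and `b` stand for `σₖ` and `σₖ₊₁`. -/

/-- `c = (a² + b²) / 2 - η²`. -/
def attackC (a b η : ℝ) : ℝ := (a ^ 2 + b ^ 2) / 2 - η ^ 2

/-- `w = (c² - a² b²) / (a² - b²)²`. -/
def attackW (a b η : ℝ) : ℝ :=
  (attackC a b η ^ 2 - a ^ 2 * b ^ 2) / (a ^ 2 - b ^ 2) ^ 2

/-- `e = √((1 + √(1 - 4w)) / (1 - √(1 - 4w)))`. -/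
def attackE (a b η : ℝ) : ℝ :=
  √((1 + √(1 - 4 * attackW a b η)) / (1 - √(1 - 4 * attackW a b η)))

/-- `λ_max = (e² - 1) / (2e)`. -/
def attackLambda (a b η : ℝ) : ℝ :=
  (attackE a b η ^ 2 - 1) / (2 * attackE a b η)

/-- `θ* = arctan(λ_max) / 2`. -/
def attackTheta (a b η : ℝ) : ℝ := Real.arctan (attackLambda a b η) / 2

/-- `m = √(λ_max² + 1) + λ_max`. -/
def attackM (a b η : ℝ) : ℝ := √(attackLambda a b η ^ 2 + 1) + attackLambda a b η

/-- The entry `p₁₁ = p₂₂ = 1 / √(m² + 1)` of the rotation matrix `P`. -/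
def attackP11 (a b η : ℝ) : ℝ := 1 / √(attackM a b η ^ 2 + 1)

/-- The entry `p₂₁ = -p₁₂ = m / √(m² + 1)` of the rotation matrix `P`. -/
def attackP21 (a b η : ℝ) : ℝ := attackM a b η / √(attackM a b η ^ 2 + 1)

/-- `A = √(p₁₁² a² + p₂₁² b²)`. -/
def attackA (a b η : ℝ) : ℝ :=
  √(attackP11 a b η ^ 2 * a ^ 2 + attackP21 a b η ^ 2 * b ^ 2)

/-- `A' = √(p₂₁² a² + p₁₁² b²)`. -/
def attackA' (a b η : ℝ) : ℝ :=
  √(attackP21 a b η ^ 2 * a ^ 2 + attackP11 a b η ^ 2 * b ^ 2)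

/-- `r = (A + A') / 2`. -/
def attackR (a b η : ℝ) : ℝ := (attackA a b η + attackA' a b η) / 2

/-- The matrix with rows `(v₁, v₃) = r (p₁₁ a, p₂₁ b) / A` and
`(v₂, v₄) = r (-p₂₁ a, p₁₁ b) / A'`. -/
def attackV (a b η : ℝ) : Matrix (Fin 2) (Fin 2) ℝ :=
  !![attackR a b η * (attackP11 a b η * a / attackA a b η),
      attackR a b η * (attackP21 a b η * b / attackA a b η);
    attackR a b η * (-attackP21 a b η * a / attackA' a b η),
      attackR a b η * (attackP11 a b η * b / attackA' a b η)]

/-- The block `[[b_{k,k}, b_{k,k+1}], [b_{k+1,k}, b_{k+1,k+1}]] = P · V - diag(a, b)` of the optimal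
attack for a small energy budget. -/
def smallBudgetBlock (a b η : ℝ) : Matrix (Fin 2) (Fin 2) ℝ :=
  !![attackP11 a b η, -attackP21 a b η; attackP21 a b η, attackP11 a b η] * attackV a b η -
    !![a, 0; 0, b]

/-- The matrix `M` with both its off-diagonal entries multiplied by `ε`. -/
def scaleOffDiag (ε : ℝ) (M : Matrix (Fin 2) (Fin 2) ℝ) : Matrix (Fin 2) (Fin 2) ℝ :=
  !![M 0 0, ε * M 0 1; ε * M 1 0, M 1 1]

/-- The block `diag(-η/√2, η/√2)` of the optimal attack for a large energy budget. -/
def largeBudgetBlock (η : ℝ) : Matrix (Fin 2) (Fin 2) ℝ :=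
  !![-η / √2, 0; 0, η / √2]

/-- The `d × n` matrix whose `k`-th and `(k+1)`-st rows and columns (counted from `1`) carry the
`2 × 2` block `M` and whose other entries vanish. -/
def embedBlock (d n k : ℕ) (M : Matrix (Fin 2) (Fin 2) ℝ) : Matrix (Fin d) (Fin n) ℝ :=
  Matrix.of fun i j =>
    if (i : ℕ) + 1 = k ∧ (j : ℕ) + 1 = k then M 0 0
    else if (i : ℕ) + 1 = k ∧ (j : ℕ) = k then M 0 1
    else if (i : ℕ) = k ∧ (j : ℕ) + 1 = k then M 1 0
    else if (i : ℕ) = k ∧ (j : ℕ) = k then M 1 1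
    else 0

end

/-!
Write `a = σₖ`, `b = σₖ₊₁`, and let `u` be the left singular vectors of `X`.

*Reduction to a plane.* The last pair of principal vectors `p ∈ P`, `q ∈ Q` spans a plane which also
contains unit vectors `p' ∈ Pᗮ` and `q' ∈ Qᗮ` (`exists_principal_plane`). On this plane `Xᵀ`
stretches `p` by at least `a` and `p'` by at most `b`, with orthogonal images, while for
`Y = X + ΔX` the images of `q` and `q'` under `Yᵀ` are orthogonal and the first one is
at least as long (`pca_split`).
Whenever `Xᵀ` stretches two orthonormal vectors by at least `A` and at most `B ≤ A`, respectively,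
but `Yᵀ` does not stretch the first one more than the second, then `2 ‖ΔX‖² ≥ (A - B)²`
(`sub_sq_le_two_mul_norm_sq`). This is used twice:

* If the angle `θ` of `p` and `q` is at least `π / 4`, then `Yᵀ` stretches `p'` at least as much as
  `p`, so `2 ‖ΔX‖² ≥ (a - b)²`. Hence the angle stays below `π / 4` for a small budget.
* The diagonals `(q ± q') / √2` are stretched equally by `Yᵀ`, and the lengths of their images under
  `Xᵀ` have the squares `(α² + β²) / 2 ± sin (2 θ) (α² - β²) / 2` with `α ≥ a`, `β ≤ b`. The
  difference of the lengths is smallest for `α = a`, `β = b` (`sqrt_sub_sqrt_le`), and the resulting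
  inequality says `sin² (2 θ) ≤ 1 - 4 w = sin² (2 θ*)` (`le_attackSin`).

*Attainment.* The closed forms simplify to `p₁² = (1 - s) / 2` and `p₂² = (1 + s) / 2` with
`s = √(1 - 4 w) = sin (2 θ*)`. The perturbed `2 × 2` block of singular values has the leading left
singular vector `((p₁ + p₂) / √2, ±(p₂ - p₁) / √2)`, at the angle `θ*` from `uₖ`
(`smallBudget_apply`), and its eigenvalues are placed such that every PCA subspace of the modified
matrix is spanned by `u₁, …, uₖ₋₁` and this vector (`smallBudget_forall`). For a large budget the
eigenvector `uₖ₊₁`, which is orthogonal to `P`, enters the PCA subspace (`largeBudget_forall`,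
`largeBudget_exists_of_eq`). Both use that an eigenvector whose eigenvalue exceeds those of `d - k`
orthonormal eigenvectors lies in every PCA subspace (`mem_span_leading_of_eigenvalue_gt`).

Every PCA subspace of `X` comes from a full singular value decomposition (`exists_isFullSVD`), so
the explicit attacks settle the optimal value for all of them.
-/

noncomputable section

/-! ### Sorted eigenbases of symmetric operators -/

section Spectral

variable {E : Type*} [NormedAddCommGroup E] [InnerProductSpace ℝ E]

theorem inner_eq_zero_of_eigenvalue_ne {T : E →ₗ[ℝ] E} (hT : T.IsSymmetric) {x y : E} {s t : ℝ}
    (hx : T x = s • x) (hy : T y = t • y) (hst : s ≠ t) : inner ℝ x y = 0 := by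
  have h := hT x y
  rw [hx, hy, real_inner_smul_left, real_inner_smul_right] at h
  have h' : (s - t) * inner ℝ x y = 0 := by linarith
  exact (mul_eq_zero.1 h').resolve_left (sub_ne_zero.2 hst)

/-- Orthonormal eigenvectors with eigenvalues at least `t` and orthonormal eigenvectors with
eigenvalues below `t` together form an orthonormal family, so the dimension bounds their number. -/
theorem card_add_card_le_finrank [FiniteDimensional ℝ E] {T : E →ₗ[ℝ] E} (hT : T.IsSymmetric)
    {ι κ : Type*} [Fintype ι] [Fintype κ] {g : ι → E} {f : κ → E} {α : ι → ℝ} {β : κ → ℝ} {t : ℝ}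
    (hg : Orthonormal ℝ g) (hf : Orthonormal ℝ f)
    (hgT : ∀ i, T (g i) = α i • g i) (hfT : ∀ j, T (f j) = β j • f j)
    (hα : ∀ i, t ≤ α i) (hβ : ∀ j, β j < t) :
    Fintype.card ι + Fintype.card κ ≤ Module.finrank ℝ E := by
  have h0 : ∀ i j, inner ℝ (g i) (f j) = 0 := fun i j =>
    inner_eq_zero_of_eigenvalue_ne hT (hgT i) (hfT j) ((hβ j).trans_le (hα i)).ne'
  have hon : Orthonormal ℝ (Sum.elim g f) := by
    refine ⟨?_, ?_⟩
    · rintro (i | j)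
      · exact hg.1 i
      · exact hf.1 j
    · rintro (i | i) (j | j) hij
      · exact hg.2 (fun h => hij (by rw [h]))
      · exact h0 i j
      · exact (real_inner_comm _ _).trans (h0 j i)
      · exact hf.2 (fun h => hij (by rw [h]))
  simpa using hon.linearIndependent.fintype_card_le_finrank

variable {d : ℕ}

/-- An eigenvector whose eigenvalue exceeds those of `d - k` orthonormal eigenvectors lies in the
span of the `k` leading vectors of every sorted eigenbasis. -/
theorem mem_span_leading_of_eigenvalue_gt {T : E →ₗ[ℝ] E} (hT : T.IsSymmetric)
    (w : OrthonormalBasis (Fin d) ℝ E) {μ : Fin d → ℝ} (hμ : Antitone μ)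
    (hw : ∀ i, T (w i) = μ i • w i) {k : ℕ} {x : E} {τ : ℝ} (hx : T x = τ • x)
    {f : {i : Fin d // k ≤ (i : ℕ)} → E} {β : {i : Fin d // k ≤ (i : ℕ)} → ℝ}
    (hf : Orthonormal ℝ f) (hfT : ∀ j, T (f j) = β j • f j) (hβ : ∀ j, β j < τ) :
    x ∈ Submodule.span ℝ (w '' {i | (i : ℕ) < k}) := by
  have : FiniteDimensional ℝ E := w.toBasis.finiteDimensional_of_finite
  have hlt : ∀ i : Fin d, k ≤ (i : ℕ) → μ i < τ := by
    intro i hi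
    by_contra! hcon
    -- otherwise `w 0, …, w i` and `f` are too many orthonormal vectors
    have hcard := card_add_card_le_finrank (t := τ) hT
      (w.orthonormal.comp (fun j : {j : Fin d // j ≤ i} => (j : Fin d)) Subtype.val_injective) hf
      (fun j => hw j) hfT (fun j => hcon.trans (hμ j.2)) hβ
    rw [Module.finrank_eq_card_basis w.toBasis, Fintype.card_fin] at hcard
    have h1 : Fintype.card {j : Fin d // j ≤ i} = i + 1 := by
      rw [Fintype.card_subtype, Finset.filter_ge_eq_Iic, Fin.card_Iic]
    have h2 : Fintype.card {j : Fin d // k ≤ (j : ℕ)} = d - k := by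
      have hd : k < d := hi.trans_lt i.2
      rw [Fintype.card_subtype]
      have : (Finset.univ.filter fun j : Fin d => k ≤ (j : ℕ)) = Finset.Ici ⟨k, hd⟩ := by
        ext j; simp [Fin.le_def]
      rw [this, Fin.card_Ici]
    omega
  rw [← w.sum_repr' x]
  refine Submodule.sum_mem _ fun i _ => ?_
  by_cases hi : (i : ℕ) < k
  · exact Submodule.smul_mem _ _ (Submodule.subset_span ⟨i, hi, rfl⟩)
  · rw [inner_eq_zero_of_eigenvalue_ne hT (hw i) hx (hlt i (not_lt.1 hi)).ne, zero_smul]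
    exact Submodule.zero_mem _

theorem sorted_eigenvalues_le {T : E →ₗ[ℝ] E} (hT : T.IsSymmetric)
    (w w' : OrthonormalBasis (Fin d) ℝ E) {μ μ' : Fin d → ℝ} (hμ : Antitone μ) (hμ' : Antitone μ')
    (hw : ∀ i, T (w i) = μ i • w i) (hw' : ∀ i, T (w' i) = μ' i • w' i) (i : Fin d) :
    μ i ≤ μ' i := by
  have : FiniteDimensional ℝ E := w.toBasis.finiteDimensional_of_finite
  by_contra! hcon
  have hcard := card_add_card_le_finrank (t := μ i) hT
    (w.orthonormal.comp (fun j : {j : Fin d // j ≤ i} => (j : Fin d)) Subtype.val_injective)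
    (w'.orthonormal.comp (fun j : {j : Fin d // i ≤ j} => (j : Fin d)) Subtype.val_injective)
    (fun j => hw j) (fun j => hw' j) (fun j => hμ j.2) (fun j => (hμ' j.2).trans_lt hcon)
  rw [Module.finrank_eq_card_basis w.toBasis, Fintype.card_fin, Fintype.card_subtype,
    Fintype.card_subtype, Finset.filter_ge_eq_Iic, Finset.filter_le_eq_Ici, Fin.card_Iic,
    Fin.card_Ici] at hcard
  omega

/-- The non-increasing list of eigenvalues does not depend on the eigenbasis. -/
theorem sorted_eigenvalues_unique {T : E →ₗ[ℝ] E} (hT : T.IsSymmetric)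
    (w w' : OrthonormalBasis (Fin d) ℝ E) {μ μ' : Fin d → ℝ} (hμ : Antitone μ) (hμ' : Antitone μ')
    (hw : ∀ i, T (w i) = μ i • w i) (hw' : ∀ i, T (w' i) = μ' i • w' i) : μ = μ' :=
  funext fun i => le_antisymm (sorted_eigenvalues_le hT w w' hμ hμ' hw hw' i)
    (sorted_eigenvalues_le hT w' w hμ' hμ hw' hw i)

theorem inner_eq_zero_of_mem_span_image (w : OrthonormalBasis (Fin d) ℝ E) {s : Set (Fin d)}
    {x : E} (hx : x ∈ Submodule.span ℝ (w '' s)) {i : Fin d} (hi : i ∉ s) :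
    inner ℝ (w i) x = 0 := by
  induction hx using Submodule.span_induction with
  | mem y hy =>
    obtain ⟨j, hj, rfl⟩ := hy
    exact w.orthonormal.2 fun h => hi (h ▸ hj)
  | zero => exact inner_zero_right _
  | add y z _ _ hy hz => rw [inner_add_right, hy, hz, add_zero]
  | smul c y _ hy => rw [real_inner_smul_right, hy, mul_zero]

theorem inner_map_self_eq_sum {T : E →ₗ[ℝ] E}
    (w : OrthonormalBasis (Fin d) ℝ E) {μ : Fin d → ℝ} (hw : ∀ i, T (w i) = μ i • w i) (x y : E) :
    inner ℝ (T x) y = ∑ i, μ i * (inner ℝ (w i) x * inner ℝ (w i) y) := by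
  conv_lhs => rw [← w.sum_repr' x]
  simp only [map_sum, map_smul, sum_inner, hw, real_inner_smul_left]
  exact Finset.sum_congr rfl fun i _ => by ring

theorem norm_sq_eq_sum (w : OrthonormalBasis (Fin d) ℝ E) (x : E) :
    ‖x‖ ^ 2 = ∑ i, inner ℝ (w i) x * inner ℝ (w i) x := by
  rw [← real_inner_self_eq_norm_sq, ← w.sum_inner_mul_inner x x]
  exact Finset.sum_congr rfl fun i _ => by rw [real_inner_comm]

end Spectral

/-! ### The operators `A Aᵀ` and PCA subspaces -/

section PCA

variable {d n k : ℕ}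

theorem inner_toEuclideanLin_transpose (A : Matrix (Fin d) (Fin n) ℝ)
    (x : EuclideanSpace ℝ (Fin d)) (y : EuclideanSpace ℝ (Fin n)) :
    inner ℝ (Matrix.toEuclideanLin Aᵀ x) y = inner ℝ x (Matrix.toEuclideanLin A y) := by
  rw [← Matrix.conjTranspose_eq_transpose_of_trivial,
    Matrix.toEuclideanLin_conjTranspose_eq_adjoint,
    LinearMap.adjoint_inner_left]

theorem inner_toEuclideanLin (A : Matrix (Fin d) (Fin n) ℝ)
    (x : EuclideanSpace ℝ (Fin n)) (y : EuclideanSpace ℝ (Fin d)) :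
    inner ℝ (Matrix.toEuclideanLin A x) y = inner ℝ x (Matrix.toEuclideanLin Aᵀ y) := by
  rw [real_inner_comm, ← inner_toEuclideanLin_transpose, real_inner_comm]

theorem toEuclideanLin_mul_apply {m : ℕ} (A : Matrix (Fin d) (Fin n) ℝ)
    (B : Matrix (Fin n) (Fin m) ℝ) (x : EuclideanSpace ℝ (Fin m)) :
    Matrix.toEuclideanLin (A * B) x = Matrix.toEuclideanLin A (Matrix.toEuclideanLin B x) := by
  rw [Matrix.toEuclideanLin, Matrix.toLpLin_mul 2 2 2]; rfl

theorem inner_toEuclideanLin_mul_transpose (A : Matrix (Fin d) (Fin n) ℝ)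
    (x y : EuclideanSpace ℝ (Fin d)) :
    inner ℝ (Matrix.toEuclideanLin (A * Aᵀ) x) y =
      inner ℝ (Matrix.toEuclideanLin Aᵀ x) (Matrix.toEuclideanLin Aᵀ y) := by
  rw [toEuclideanLin_mul_apply, inner_toEuclideanLin]

theorem isSymmetric_mul_transpose (A : Matrix (Fin d) (Fin n) ℝ) :
    (Matrix.toEuclideanLin (A * Aᵀ)).IsSymmetric := by
  rw [Matrix.isSymmetric_toEuclideanLin_iff]
  simpa using Matrix.isHermitian_mul_conjTranspose_self A

theorem exists_isPCASubspace (k : ℕ) (A : Matrix (Fin d) (Fin n) ℝ) :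
    ∃ Q, IsPCASubspace k A Q := by
  have hT := isSymmetric_mul_transpose A
  have hd : Module.finrank ℝ (EuclideanSpace ℝ (Fin d)) = d := by simp
  exact ⟨_, hT.eigenvectorBasis hd, hT.eigenvalues hd, hT.eigenvalues_antitone hd,
    fun i => hT.apply_eigenvectorBasis hd i, rfl⟩

theorem finrank_span_leading {E : Type*} [NormedAddCommGroup E] [InnerProductSpace ℝ E]
    (w : OrthonormalBasis (Fin d) ℝ E) (hkd : k ≤ d) :
    Module.finrank ℝ (Submodule.span ℝ (w '' {i | (i : ℕ) < k})) = k := by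
  have h := finrank_span_eq_card (R := ℝ) (b := fun i : Fin k => w (Fin.castLE hkd i))
    (w.orthonormal.comp _ (Fin.castLE_injective hkd)).linearIndependent
  rw [Fintype.card_fin] at h
  have hs : w '' {i | (i : ℕ) < k} = Set.range fun i : Fin k => w (Fin.castLE hkd i) := by
    ext x
    constructor
    · rintro ⟨i, hi, rfl⟩; exact ⟨⟨i, hi⟩, rfl⟩
    · rintro ⟨i, rfl⟩; exact ⟨_, i.2, rfl⟩
  rw [hs, h]

theorem IsPCASubspace.finrank_eq {A : Matrix (Fin d) (Fin n) ℝ}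
    {Q : Submodule ℝ (EuclideanSpace ℝ (Fin d))} (hQ : IsPCASubspace k A Q) (hkd : k ≤ d) :
    Module.finrank ℝ Q = k := by
  obtain ⟨w, μ, -, -, rfl⟩ := hQ
  exact finrank_span_leading w hkd

/-- `Aᵀ` stretches the vectors of a PCA subspace at least as much as the vectors orthogonal to it,
and it maps the two kinds of vectors to orthogonal ones. -/
theorem pca_split {A : Matrix (Fin d) (Fin n) ℝ}
    (w : OrthonormalBasis (Fin d) ℝ (EuclideanSpace ℝ (Fin d))) {μ : Fin d → ℝ} (hμ : Antitone μ)
    (hw : ∀ i, Matrix.toEuclideanLin (A * Aᵀ) (w i) = μ i • w i) (hk : 1 ≤ k) (hkd : k < d)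
    {x y : EuclideanSpace ℝ (Fin d)} (hx : x ∈ Submodule.span ℝ (w '' {i | (i : ℕ) < k}))
    (hy : y ∈ (Submodule.span ℝ (w '' {i | (i : ℕ) < k}))ᗮ) :
    μ ⟨k - 1, by omega⟩ * ‖x‖ ^ 2 ≤ ‖Matrix.toEuclideanLin Aᵀ x‖ ^ 2 ∧
      ‖Matrix.toEuclideanLin Aᵀ y‖ ^ 2 ≤ μ ⟨k, hkd⟩ * ‖y‖ ^ 2 ∧
      inner ℝ (Matrix.toEuclideanLin Aᵀ x) (Matrix.toEuclideanLin Aᵀ y) = 0 := by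
  have hx0 : ∀ i : Fin d, k ≤ (i : ℕ) → inner ℝ (w i) x = 0 := fun i hi =>
    inner_eq_zero_of_mem_span_image w hx (by simpa using hi)
  have hy0 : ∀ i : Fin d, (i : ℕ) < k → inner ℝ (w i) y = 0 := fun i hi =>
    hy _ (Submodule.subset_span ⟨i, hi, rfl⟩)
  refine ⟨?_, ?_, ?_⟩
  · rw [← real_inner_self_eq_norm_sq (Matrix.toEuclideanLin Aᵀ x),
      ← inner_toEuclideanLin_mul_transpose, inner_map_self_eq_sum w hw, norm_sq_eq_sum w x,
      Finset.mul_sum]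
    refine Finset.sum_le_sum fun i _ => ?_
    by_cases hi : (i : ℕ) < k
    · exact mul_le_mul_of_nonneg_right (hμ (Fin.le_def.2 (by simp; omega))) (mul_self_nonneg _)
    · simp [hx0 i (not_lt.1 hi)]
  · rw [← real_inner_self_eq_norm_sq (Matrix.toEuclideanLin Aᵀ y),
      ← inner_toEuclideanLin_mul_transpose, inner_map_self_eq_sum w hw, norm_sq_eq_sum w y,
      Finset.mul_sum]
    refine Finset.sum_le_sum fun i _ => ?_
    by_cases hi : (i : ℕ) < k
    · simp [hy0 i hi]
    · exact mul_le_mul_of_nonneg_right (hμ (Fin.le_def.2 (by simp; omega))) (mul_self_nonneg _)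
  · rw [← inner_toEuclideanLin_mul_transpose, inner_map_self_eq_sum w hw]
    refine Finset.sum_eq_zero fun i _ => ?_
    by_cases hi : (i : ℕ) < k
    · simp [hy0 i hi]
    · simp [hx0 i (not_lt.1 hi)]

end PCA

/-! ### Full singular value decompositions -/

section SVD

variable {d n k : ℕ}

theorem exists_orthonormalBasis_columns {U : Matrix (Fin d) (Fin d) ℝ}
    (hU : U ∈ Matrix.orthogonalGroup (Fin d) ℝ) :
    ∃ w : OrthonormalBasis (Fin d) ℝ (EuclideanSpace ℝ (Fin d)),
      ∀ j, w j = WithLp.toLp 2 (fun i => U i j) := by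
  have hon : Orthonormal ℝ ((Set.univ : Set (Fin d)).domRestrict
      fun j => (WithLp.toLp 2 (fun i => U i j) : EuclideanSpace ℝ (Fin d))) := by
    rw [orthonormal_iff_ite]
    rintro ⟨i, -⟩ ⟨j, -⟩
    have h := congrFun (congrFun ((Matrix.mem_orthogonalGroup_iff' (Fin d) ℝ).1 hU) i) j
    simp only [Matrix.mul_apply, Matrix.one_apply] at h
    simp only [Set.domRestrict_apply, EuclideanSpace.inner_toLp_toLp, dotProduct, star_trivial,
      Subtype.mk.injEq]
    rw [← h]
    exact Finset.sum_congr rfl fun l _ => mul_comm _ _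
  obtain ⟨w, hw⟩ := hon.exists_orthonormalBasis_extension_of_card_eq (by simp)
  exact ⟨w, fun j => hw j trivial⟩

theorem matrix_of_orthonormalBasis_mem (w : OrthonormalBasis (Fin d) ℝ (EuclideanSpace ℝ (Fin d))) :
    (Matrix.of fun i j => w j i) ∈ Matrix.orthogonalGroup (Fin d) ℝ := by
  rw [Matrix.mem_orthogonalGroup_iff']
  ext i j
  have h := orthonormal_iff_ite.1 w.orthonormal i j
  simp only [PiLp.inner_apply, RCLike.inner_apply, conj_trivial] at h
  simp only [Matrix.mul_apply, Matrix.one_apply, Matrix.of_apply]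
  rw [← h]
  exact Finset.sum_congr rfl fun l _ => mul_comm _ _

theorem leadingColumnSpan_eq {U : Matrix (Fin d) (Fin d) ℝ}
    {w : OrthonormalBasis (Fin d) ℝ (EuclideanSpace ℝ (Fin d))}
    (hw : ∀ j, w j = WithLp.toLp 2 (fun i => U i j)) (k : ℕ) :
    leadingColumnSpan k U = Submodule.span ℝ (w '' {i | (i : ℕ) < k}) := by
  unfold leadingColumnSpan
  congr 1
  ext x
  constructor
  · rintro ⟨j, hj, rfl⟩; exact ⟨j, hj, hw j⟩
  · rintro ⟨j, hj, rfl⟩; exact ⟨j, hj, hw j⟩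

theorem singVal_nonneg (X : Matrix (Fin d) (Fin n) ℝ) (i : ℕ) : 0 ≤ singVal X i :=
  LinearMap.singularValues_nonneg _ i

theorem singVal_antitone (X : Matrix (Fin d) (Fin n) ℝ) : Antitone (singVal X) :=
  LinearMap.singularValues_antitone _

theorem singVal_of_le (X : Matrix (Fin d) (Fin n) ℝ) {i : ℕ} (hi : n ≤ i) : singVal X i = 0 :=
  LinearMap.singularValues_of_finrank_le _ (by simpa using hi)

theorem singVal_pos_of_lt_rank (X : Matrix (Fin d) (Fin n) ℝ) {i : ℕ} (hi : i < X.rank) :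
    0 < singVal X i := by
  unfold singVal
  rw [LinearMap.singularValues_pos_iff_lt_finrank_range]
  rwa [Matrix.rank_eq_finrank_range_toLin X (EuclideanSpace.basisFun (Fin d) ℝ).toBasis
    (EuclideanSpace.basisFun (Fin n) ℝ).toBasis,
    ← Matrix.toEuclideanLin_eq_toLin_orthonormal] at hi

/-- A sorted orthonormal eigenbasis of `X Xᵀ` consists of the left singular vectors of a full
singular value decomposition. -/
theorem exists_isFullSVD (X : Matrix (Fin d) (Fin n) ℝ)
    (w : OrthonormalBasis (Fin d) ℝ (EuclideanSpace ℝ (Fin d))) {μ : Fin d → ℝ} (hμ : Antitone μ)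
    (hw : ∀ i, Matrix.toEuclideanLin (X * Xᵀ) (w i) = μ i • w i) :
    ∃ V, IsFullSVD X (Matrix.of fun i j => w j i) V := by
  set L := Matrix.toEuclideanLin Xᵀ with hL
  have hin : ∀ i j, inner ℝ (L (w i)) (L (w j)) = if i = j then μ i else 0 := by
    intro i j
    rw [hL, ← inner_toEuclideanLin_mul_transpose, hw, real_inner_smul_left,
      orthonormal_iff_ite.1 w.orthonormal]
    split_ifs <;> simp
  have hμ0 : ∀ i, 0 ≤ μ i := fun i => by
    have := hin i i
    rw [if_pos rfl] at this
    rw [← this]; exact real_inner_self_nonneg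
  have hL0 : ∀ i, μ i = 0 → L (w i) = 0 := fun i hi => by
    rw [← inner_self_eq_zero (𝕜 := ℝ), hin, if_pos rfl, hi]
  -- the normalized images of the eigenvectors with positive eigenvalue
  have hon : Orthonormal ℝ fun i : {i : Fin d // 0 < μ i} => (√(μ i))⁻¹ • L (w i) := by
    rw [orthonormal_iff_ite]
    rintro ⟨i, hi⟩ ⟨j, hj⟩
    rw [real_inner_smul_left, real_inner_smul_right, hin]
    by_cases h : i = j
    · subst h
      have h2 := Real.mul_self_sqrt hi.le
      have h3 : √(μ i) ≠ 0 := (Real.sqrt_pos.2 hi).ne'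
      simp only [if_true]
      field_simp
      nlinarith
    · simp [h]
  -- there are at most `n` of them
  have hn : ∀ i : Fin d, 0 < μ i → (i : ℕ) < n := by
    intro i hi
    have hc := (hon.comp (fun j : {j : Fin d // j ≤ i} =>
      (⟨j, hi.trans_le (hμ j.2)⟩ : {i : Fin d // 0 < μ i}))
      (fun a b h => Subtype.ext (by simpa using h))).linearIndependent.fintype_card_le_finrank
    rw [Fintype.card_subtype, Finset.filter_ge_eq_Iic, Fin.card_Iic, finrank_euclideanSpace,
      Fintype.card_fin] at hc
    omega
  let g : Fin n → EuclideanSpace ℝ (Fin n) := fun j =>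
    if h : (j : ℕ) < d then (√(μ ⟨j, h⟩))⁻¹ • L (w ⟨j, h⟩) else 0
  have hong : Orthonormal ℝ ({j : Fin n | ∃ h : (j : ℕ) < d, 0 < μ ⟨j, h⟩}.domRestrict g) := by
    have := hon.comp (fun j : {j : Fin n | ∃ h : (j : ℕ) < d, 0 < μ ⟨j, h⟩} =>
      (⟨⟨j, j.2.1⟩, j.2.2⟩ : {i : Fin d // 0 < μ i}))
      (fun a b h => Subtype.ext (Fin.ext (by simpa using h)))
    convert this using 1
    funext j
    simp [g, j.2.1]
  obtain ⟨b, hb⟩ := hong.exists_orthonormalBasis_extension_of_card_eq (by simp)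
  have hLb : ∀ i : Fin d, ∀ h : (i : ℕ) < n, L (w i) = √(μ i) • b ⟨i, h⟩ := by
    intro i h
    rcases (hμ0 i).eq_or_lt with h0 | h0
    · rw [hL0 i h0.symm, ← h0, Real.sqrt_zero, zero_smul]
    · rw [hb _ ⟨i.2, h0⟩]
      simp only [g, i.2, dif_pos, Fin.eta]
      rw [smul_smul, mul_inv_cancel₀ (Real.sqrt_pos.2 h0).ne', one_smul]
  have hLn : ∀ i : Fin d, n ≤ (i : ℕ) → L (w i) = 0 := fun i h =>
    hL0 i (le_antisymm (not_lt.1 fun h' => absurd (hn i h') (not_lt.2 h)) (hμ0 i))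
  have hLin : ∀ (i : Fin d) (j : Fin n), inner ℝ (L (w i)) (b j) =
      if (i : ℕ) = (j : ℕ) then √(μ i) else 0 := by
    intro i j
    rcases lt_or_ge (i : ℕ) n with h | h
    · rw [hLb i h, real_inner_smul_left, orthonormal_iff_ite.1 b.orthonormal]
      simp [Fin.ext_iff]
    · rw [hLn i h, inner_zero_left, if_neg (by omega)]
  -- `b` is a sorted eigenbasis of `Xᵀ X`, which identifies the singular values
  have hXb : ∀ j : Fin n, Matrix.toEuclideanLin X (b j) =
      if h : (j : ℕ) < d then √(μ ⟨j, h⟩) • w ⟨j, h⟩ else 0 := by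
    intro j
    rw [← w.sum_repr' (Matrix.toEuclideanLin X (b j))]
    simp only [← inner_toEuclideanLin_transpose, ← hL, hLin]
    split_ifs with h
    · rw [Finset.sum_eq_single ⟨j, h⟩]
      · simp
      · intro i _ hi
        rw [if_neg (fun h' => hi (Fin.ext h')), zero_smul]
      · simp
    · refine Finset.sum_eq_zero fun i _ => ?_
      rw [if_neg (by omega), zero_smul]
  have hadj : LinearMap.adjoint (Matrix.toEuclideanLin X) = L := by
    rw [← Matrix.toEuclideanLin_conjTranspose_eq_adjoint,
      Matrix.conjTranspose_eq_transpose_of_trivial]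
  let ν : Fin n → ℝ := fun j => if h : (j : ℕ) < d then μ ⟨j, h⟩ else 0
  have hν : Antitone ν := by
    intro i j hij
    have : (i : ℕ) ≤ j := hij
    simp only [ν]
    split_ifs with h1 h2 h2
    · exact hμ (Fin.le_def.2 this)
    · omega
    · exact hμ0 _
    · exact le_rfl
  have hνb : ∀ j, (LinearMap.adjoint (Matrix.toEuclideanLin X) ∘ₗ Matrix.toEuclideanLin X) (b j) =
      ν j • b j := by
    intro j
    rw [LinearMap.comp_apply, hXb, hadj]
    simp only [ν]
    split_ifs with h
    · rw [map_smul, hLb _ j.2, smul_smul, Real.mul_self_sqrt (hμ0 _)]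
    · simp
  have hdim : Module.finrank ℝ (EuclideanSpace ℝ (Fin n)) = n := by simp
  have hT := (Matrix.toEuclideanLin X).isSymmetric_adjoint_comp_self
  have heig := sorted_eigenvalues_unique hT (hT.eigenvectorBasis hdim) b
    (hT.eigenvalues_antitone hdim) hν (fun i => hT.apply_eigenvectorBasis hdim i) hνb
  have hσ : ∀ i : Fin d, √(μ i) = singVal X i := by
    intro i
    rcases lt_or_ge (i : ℕ) n with h | h
    · unfold singVal
      rw [LinearMap.singularValues_of_lt _ hdim h, heig]
      simp [ν]
    · rw [singVal_of_le X h]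
      have : μ i = 0 := le_antisymm (not_lt.1 fun h' => absurd (hn i h') (not_lt.2 h)) (hμ0 i)
      rw [this, Real.sqrt_zero]
  refine ⟨Matrix.of fun i j => b j i, matrix_of_orthonormalBasis_mem w,
    matrix_of_orthonormalBasis_mem b, ?_⟩
  have hU := (Matrix.mem_orthogonalGroup_iff (Fin d) ℝ).1 (matrix_of_orthonormalBasis_mem w)
  have hV := (Matrix.mem_orthogonalGroup_iff (Fin n) ℝ).1 (matrix_of_orthonormalBasis_mem b)
  set U : Matrix (Fin d) (Fin d) ℝ := Matrix.of fun i j => w j i with hUdef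
  set V : Matrix (Fin n) (Fin n) ℝ := Matrix.of fun i j => b j i with hVdef
  have hmid : Uᵀ * X * V = rectDiag d n (singVal X) := by
    ext i j
    have h1 := hLin i j
    rw [hL, inner_toEuclideanLin_transpose, hσ] at h1
    simp only [rectDiag, Matrix.of_apply]
    rw [← h1, Matrix.mul_assoc]
    simp only [PiLp.inner_apply, RCLike.inner_apply, conj_trivial, Matrix.toLpLin_apply,
      Matrix.toEuclideanLin, Matrix.mul_apply, Matrix.mulVec, dotProduct, Matrix.transpose_apply,
      hUdef, hVdef, Matrix.of_apply]
    exact Finset.sum_congr rfl fun l _ => mul_comm _ _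
  rw [← hmid]
  have hU' : U * Uᵀ = 1 := hU
  have hV' : V * Vᵀ = 1 := hV
  calc X = (U * Uᵀ) * X * (V * Vᵀ) := by rw [hU', hV', Matrix.one_mul, Matrix.mul_one]
    _ = _ := by simp only [Matrix.mul_assoc]

theorem norm_sq_eq_sum_sq (M : Matrix (Fin d) (Fin n) ℝ) : ‖M‖ ^ 2 = ∑ i, ∑ j, M i j ^ 2 := by
  rw [Matrix.frobenius_norm_def, ← Real.sqrt_eq_rpow, Real.sq_sqrt]
  · simp
  · positivity

theorem norm_sq_eq_trace (M : Matrix (Fin d) (Fin n) ℝ) : ‖M‖ ^ 2 = (M * Mᵀ).trace := by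
  rw [norm_sq_eq_sum_sq]
  simp [Matrix.trace, Matrix.mul_apply, pow_two]

/-- The Frobenius norm is invariant under orthogonal transformations on both sides. -/
theorem norm_orthogonal_mul_mul {U : Matrix (Fin d) (Fin d) ℝ} {V : Matrix (Fin n) (Fin n) ℝ}
    (hU : U ∈ Matrix.orthogonalGroup (Fin d) ℝ) (hV : V ∈ Matrix.orthogonalGroup (Fin n) ℝ)
    (M : Matrix (Fin d) (Fin n) ℝ) : ‖U * M * Vᵀ‖ = ‖M‖ := by
  have hU' : Uᵀ * U = 1 := (Matrix.mem_orthogonalGroup_iff' (Fin d) ℝ).1 hU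
  have hV' : Vᵀ * V = 1 := (Matrix.mem_orthogonalGroup_iff' (Fin n) ℝ).1 hV
  have h : ‖U * M * Vᵀ‖ ^ 2 = ‖M‖ ^ 2 := by
    have e : U * M * Vᵀ * (U * M * Vᵀ)ᵀ = U * ((M * ((Vᵀ * V) * Mᵀ)) * Uᵀ) := by
      simp only [Matrix.transpose_mul, Matrix.transpose_transpose, Matrix.mul_assoc]
    rw [norm_sq_eq_trace, norm_sq_eq_trace, e, hV', Matrix.one_mul, Matrix.trace_mul_comm,
      Matrix.mul_assoc, hU', Matrix.mul_one]
  exact (pow_left_inj₀ (norm_nonneg _) (norm_nonneg _) two_ne_zero).1 h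

/-- In the coordinates given by the columns of `U`, the operator `Y Yᵀ` of `Y = U S Vᵀ` is
`S Sᵀ`. -/
theorem toEuclideanLin_conj_apply {U : Matrix (Fin d) (Fin d) ℝ} {V : Matrix (Fin n) (Fin n) ℝ}
    (hU : U ∈ Matrix.orthogonalGroup (Fin d) ℝ) (hV : V ∈ Matrix.orthogonalGroup (Fin n) ℝ)
    (S : Matrix (Fin d) (Fin n) ℝ) (z : Fin d → ℝ) :
    Matrix.toEuclideanLin ((U * S * Vᵀ) * (U * S * Vᵀ)ᵀ) (WithLp.toLp 2 (U *ᵥ z)) =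
      WithLp.toLp 2 (U *ᵥ ((S * Sᵀ) *ᵥ z)) := by
  have hU' : Uᵀ * U = 1 := (Matrix.mem_orthogonalGroup_iff' (Fin d) ℝ).1 hU
  have hV' : Vᵀ * V = 1 := (Matrix.mem_orthogonalGroup_iff' (Fin n) ℝ).1 hV
  have e : U * S * Vᵀ * (U * S * Vᵀ)ᵀ * U = U * (S * Sᵀ) := by
    calc _ = U * (S * ((Vᵀ * V) * (Sᵀ * (Uᵀ * U)))) := by
          simp only [Matrix.transpose_mul, Matrix.transpose_transpose, Matrix.mul_assoc]
      _ = _ := by rw [hU', hV', Matrix.mul_one, Matrix.one_mul]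
  rw [Matrix.toEuclideanLin, Matrix.toLpLin_apply]
  simp only [Matrix.mulVec_mulVec, e]

end SVD

/-! ### Principal vectors and the Asimov distance -/

section Asimov

variable {d k : ℕ} {P Q : Submodule ℝ (EuclideanSpace ℝ (Fin d))}
  {u v : Fin k → EuclideanSpace ℝ (Fin d)}

theorem eq_sum_inner_of_mem_span_range {E : Type*} [NormedAddCommGroup E] [InnerProductSpace ℝ E]
    {ι : Type*} [Fintype ι] {u : ι → E} (hu : Orthonormal ℝ u) {x : E}
    (hx : x ∈ Submodule.span ℝ (Set.range u)) : x = ∑ i, inner ℝ (u i) x • u i := by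
  obtain ⟨c, rfl⟩ := (Submodule.mem_span_range_iff_exists_fun ℝ).1 hx
  simp only [hu.inner_right_fintype]

theorem span_range_eq_of_orthonormal (hP : Module.finrank ℝ P = k) (hu : Orthonormal ℝ u)
    (hm : ∀ i, u i ∈ P) : Submodule.span ℝ (Set.range u) = P := by
  refine Submodule.eq_of_le_of_finrank_eq ?_ ?_
  · rw [Submodule.span_le]; rintro _ ⟨i, rfl⟩; exact hm i
  · rw [finrank_span_eq_card hu.linearIndependent, Fintype.card_fin, hP]

theorem exists_unit_mem_orthogonal (hP : Module.finrank ℝ P = k) (i : Fin k)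
    (hm : ∀ j < i, u j ∈ P) : ∃ x ∈ P, ‖x‖ = 1 ∧ ∀ j < i, inner ℝ (u j) x = 0 := by
  set K := Submodule.span ℝ (Set.range fun j : {j : Fin k // j < i} => u j)
  have hK : K ≤ P := by
    rw [Submodule.span_le]; rintro _ ⟨j, rfl⟩; exact hm j j.2
  have h1 : Module.finrank ℝ K ≤ i := by
    refine (finrank_range_le_card _).trans ?_
    rw [Fintype.card_subtype, Finset.filter_gt_eq_Iio, Fin.card_Iio]
  have h2 := Submodule.finrank_add_inf_finrank_orthogonal hK
  have h3 : Kᗮ ⊓ P ≠ ⊥ := by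
    intro h
    rw [h, finrank_bot, hP] at h2
    have := i.2
    omega
  obtain ⟨x, hx, hx0⟩ := Submodule.exists_mem_ne_zero_of_ne_bot h3
  have hn : ‖x‖ ≠ 0 := norm_ne_zero_iff.2 hx0
  refine ⟨‖x‖⁻¹ • x, P.smul_mem _ hx.2, ?_, fun j hj => ?_⟩
  · rw [norm_smul, norm_inv, norm_norm, inv_mul_cancel₀ hn]
  · rw [real_inner_smul_right, hx.1 _ (Submodule.subset_span ⟨⟨j, hj⟩, rfl⟩), mul_zero]

theorem principalFeasible_congr {u' v' : Fin k → EuclideanSpace ℝ (Fin d)} {i : Fin k}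
    (hu : ∀ j < i, u' j = u j) (hv : ∀ j < i, v' j = v j) (x y : EuclideanSpace ℝ (Fin d)) :
    PrincipalFeasible P Q u' v' i x y ↔ PrincipalFeasible P Q u v i x y := by
  unfold PrincipalFeasible
  have : (∀ j < i, inner ℝ (u' j) x = 0 ∧ inner ℝ (v' j) y = 0) ↔
      ∀ j < i, inner ℝ (u j) x = 0 ∧ inner ℝ (v j) y = 0 :=
    forall₂_congr fun j hj => by rw [hu j hj, hv j hj]
  rw [this]

theorem exists_isMaxOn_principalFeasible (hP : Module.finrank ℝ P = k)
    (hQ : Module.finrank ℝ Q = k) (i : Fin k) (hu : ∀ j < i, u j ∈ P) (hv : ∀ j < i, v j ∈ Q) :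
    ∃ a b, PrincipalFeasible P Q u v i a b ∧
      ∀ x y, PrincipalFeasible P Q u v i x y → inner ℝ x y ≤ inner ℝ a b := by
  set F : Set (EuclideanSpace ℝ (Fin d) × EuclideanSpace ℝ (Fin d)) :=
    {z | PrincipalFeasible P Q u v i z.1 z.2} with hF
  have hne : F.Nonempty := by
    obtain ⟨x, hx, hx1, hx0⟩ := exists_unit_mem_orthogonal hP i hu
    obtain ⟨y, hy, hy1, hy0⟩ := exists_unit_mem_orthogonal hQ i hv
    exact ⟨(x, y), hx, hy, hx1, hy1, fun j hj => ⟨hx0 j hj, hy0 j hj⟩⟩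
  have hclosed : IsClosed F := by
    have : F = (Prod.fst ⁻¹' (P : Set _)) ∩ ((Prod.snd ⁻¹' (Q : Set _)) ∩ ({z | ‖z.1‖ = 1} ∩
        ({z | ‖z.2‖ = 1} ∩ ⋂ j : Fin k, ⋂ _ : j < i,
          ({z | inner ℝ (u j) z.1 = 0} ∩ {z | inner ℝ (v j) z.2 = 0})))) := by
      ext z; simp [hF, PrincipalFeasible]
    rw [this]
    refine (P.closed_of_finiteDimensional.preimage continuous_fst).inter
      ((Q.closed_of_finiteDimensional.preimage continuous_snd).inter
      ((isClosed_eq (by fun_prop) continuous_const).inter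
      ((isClosed_eq (by fun_prop) continuous_const).inter
      (isClosed_iInter fun j => isClosed_iInter fun _ =>
        (isClosed_eq (by fun_prop) continuous_const).inter
        (isClosed_eq (by fun_prop) continuous_const)))))
  have hcomp : IsCompact F := by
    refine ((isCompact_closedBall 0 1).prod (isCompact_closedBall 0 1)).of_isClosed_subset
      hclosed ?_
    rintro ⟨x, y⟩ ⟨-, -, hx, hy, -⟩
    exact ⟨by simpa using hx.le, by simpa using hy.le⟩
  obtain ⟨⟨a, b⟩, hab, hmax⟩ := hcomp.exists_isMaxOn hne
    (f := fun z => inner ℝ z.1 z.2) (by fun_prop)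
  exact ⟨a, b, hab, fun x y hxy => hmax (show (x, y) ∈ F from hxy)⟩

theorem exists_isPrincipalVectors (hP : Module.finrank ℝ P = k) (hQ : Module.finrank ℝ Q = k) :
    ∃ u v : Fin k → EuclideanSpace ℝ (Fin d), IsPrincipalVectors P Q u v := by
  have key : ∀ m ≤ k, ∃ u v : Fin k → EuclideanSpace ℝ (Fin d), ∀ i : Fin k, (i : ℕ) < m →
      PrincipalFeasible P Q u v i (u i) (v i) ∧
        ∀ x y, PrincipalFeasible P Q u v i x y → inner ℝ x y ≤ inner ℝ (u i) (v i) := by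
    intro m
    induction m with
    | zero => exact fun _ => ⟨0, 0, fun i hi => absurd hi (Nat.not_lt_zero _)⟩
    | succ m ih =>
      intro hm
      obtain ⟨u, v, huv⟩ := ih (by omega)
      set i₀ : Fin k := ⟨m, hm⟩
      obtain ⟨a, b, hab, hmax⟩ := exists_isMaxOn_principalFeasible (u := u) (v := v) hP hQ i₀
        (fun j hj => (huv j hj).1.1) (fun j hj => (huv j hj).1.2.1)
      refine ⟨Function.update u i₀ a, Function.update v i₀ b, fun i hi => ?_⟩
      have hcongr : ∀ x y, PrincipalFeasible P Q (Function.update u i₀ a)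
          (Function.update v i₀ b) i x y ↔ PrincipalFeasible P Q u v i x y := by
        refine principalFeasible_congr (fun j hj => ?_) (fun j hj => ?_) <;>
        · refine Function.update_of_ne (fun h => ?_) _ _
          have h1 : (j : ℕ) < i := hj
          rw [h] at h1
          have h2 : (i₀ : ℕ) = m := rfl
          omega
      simp only [hcongr]
      by_cases h : i = i₀
      · subst h
        simpa using ⟨hab, hmax⟩
      · rw [Function.update_of_ne h, Function.update_of_ne h]
        exact huv i (lt_of_le_of_ne (Nat.lt_succ_iff.1 hi) fun h' => h (Fin.ext h'))
  obtain ⟨u, v, huv⟩ := key k le_rfl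
  exact ⟨u, v, fun i => huv i i.2⟩

namespace IsPrincipalVectors

theorem orthonormal_left (h : IsPrincipalVectors P Q u v) : Orthonormal ℝ u := by
  refine ⟨fun i => (h i).1.2.2.1, fun i j hij => ?_⟩
  rcases lt_or_gt_of_ne hij with hlt | hlt
  · exact ((h j).1.2.2.2.2 i hlt).1
  · exact (real_inner_comm _ _).trans ((h i).1.2.2.2.2 j hlt).1

theorem orthonormal_right (h : IsPrincipalVectors P Q u v) : Orthonormal ℝ v := by
  refine ⟨fun i => (h i).1.2.2.2.1, fun i j hij => ?_⟩
  rcases lt_or_gt_of_ne hij with hlt | hlt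
  · exact ((h j).1.2.2.2.2 i hlt).2
  · exact (real_inner_comm _ _).trans ((h i).1.2.2.2.2 j hlt).2

theorem swap (h : IsPrincipalVectors P Q u v) : IsPrincipalVectors Q P v u := by
  have hs : ∀ i x y, PrincipalFeasible Q P v u i x y → PrincipalFeasible P Q u v i y x :=
    fun i x y hxy => ⟨hxy.2.1, hxy.1, hxy.2.2.2.1, hxy.2.2.1,
      fun j hj => ⟨(hxy.2.2.2.2 j hj).2, (hxy.2.2.2.2 j hj).1⟩⟩
  refine fun i => ⟨⟨(h i).1.2.1, (h i).1.1, (h i).1.2.2.2.1, (h i).1.2.2.1, fun j hj =>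
    ⟨((h i).1.2.2.2.2 j hj).2, ((h i).1.2.2.2.2 j hj).1⟩⟩, fun x y hxy => ?_⟩
  rw [real_inner_comm, real_inner_comm (u i)]
  exact (h i).2 y x (hs i x y hxy)

theorem inner_nonneg (h : IsPrincipalVectors P Q u v) (i : Fin k) : 0 ≤ inner ℝ (u i) (v i) := by
  obtain ⟨⟨h1, h2, h3, h4, h5⟩, hmax⟩ := h i
  have := hmax (u i) (-v i) ⟨h1, Q.neg_mem h2, h3, by rwa [norm_neg],
    fun j hj => ⟨(h5 j hj).1, by rw [inner_neg_right, (h5 j hj).2, neg_zero]⟩⟩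
  rw [inner_neg_right] at this
  linarith

theorem inner_antitone (h : IsPrincipalVectors P Q u v) {i j : Fin k} (hij : i ≤ j) :
    inner ℝ (u j) (v j) ≤ inner ℝ (u i) (v i) := by
  obtain ⟨⟨h1, h2, h3, h4, h5⟩, -⟩ := h j
  exact (h i).2 _ _ ⟨h1, h2, h3, h4, fun l hl => h5 l (hl.trans_le hij)⟩

/-- A nonzero inner product of `v i` with a later `u j` would allow to increase `⟪u i, v i⟫` by
rotating `u i` towards `u j`. -/
theorem inner_eq_zero_of_lt (h : IsPrincipalVectors P Q u v) {i j : Fin k} (hij : i < j) :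
    inner ℝ (u j) (v i) = 0 := by
  set A := inner ℝ (u i) (v i) with hA
  set B := inner ℝ (u j) (v i) with hB
  by_contra hB0
  have hpos : 0 < A ^ 2 + B ^ 2 := by positivity
  set N := √(A ^ 2 + B ^ 2) with hN
  have hN0 : 0 < N := Real.sqrt_pos.2 hpos
  have hNsq : N ^ 2 = A ^ 2 + B ^ 2 := Real.sq_sqrt hpos.le
  have hu := h.orthonormal_left
  have huij : inner ℝ (u i) (u j) = 0 := hu.2 hij.ne
  obtain ⟨⟨h1, h2, h3, h4, h5⟩, hmax⟩ := h i
  have hnorm : ‖A • u i + B • u j‖ = N := by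
    rw [← pow_left_inj₀ (norm_nonneg _) hN0.le two_ne_zero, hNsq, norm_add_sq_real, norm_smul,
      norm_smul, hu.1 i, hu.1 j, real_inner_smul_left, real_inner_smul_right, huij]
    simp
  have hle := hmax (N⁻¹ • (A • u i + B • u j)) (v i) ⟨P.smul_mem _ (P.add_mem (P.smul_mem _ h1)
    (P.smul_mem _ (h j).1.1)), h2, by
      rw [norm_smul, hnorm, norm_inv, Real.norm_of_nonneg hN0.le, inv_mul_cancel₀ hN0.ne'], h4,
    fun l hl => ⟨by
      rw [real_inner_smul_right, inner_add_right, real_inner_smul_right, real_inner_smul_right,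
        hu.2 hl.ne, hu.2 (hl.trans hij).ne]; simp, (h5 l hl).2⟩⟩
  rw [real_inner_smul_left, inner_add_left, real_inner_smul_left, real_inner_smul_left, ← hA, ← hB]
    at hle
  have h6 : N⁻¹ * (A * A + B * B) = N := by
    rw [inv_mul_eq_iff_eq_mul₀ hN0.ne']; nlinarith
  rw [h6] at hle
  have : 0 < B ^ 2 := by positivity
  nlinarith

theorem inner_eq_zero_of_ne (h : IsPrincipalVectors P Q u v) {i j : Fin k} (hij : i ≠ j) :
    inner ℝ (u i) (v j) = 0 := by
  rcases lt_or_gt_of_ne hij with hlt | hlt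
  · exact (real_inner_comm _ _).trans (h.swap.inner_eq_zero_of_lt hlt)
  · exact h.inner_eq_zero_of_lt hlt

/-- The orthogonal projection of `v i` to `P` is `⟪u i, v i⟫ u i`. -/
theorem inner_sub_eq_zero (h : IsPrincipalVectors P Q u v) (hP : Module.finrank ℝ P = k)
    (i : Fin k) {x : EuclideanSpace ℝ (Fin d)} (hx : x ∈ P) :
    inner ℝ x (v i - inner ℝ (u i) (v i) • u i) = 0 := by
  have hu := h.orthonormal_left
  rw [← span_range_eq_of_orthonormal hP hu fun i => (h i).1.1] at hx
  induction hx using Submodule.span_induction with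
  | mem y hy =>
    obtain ⟨j, rfl⟩ := hy
    rw [inner_sub_right, real_inner_smul_right, orthonormal_iff_ite.1 hu]
    by_cases hij : j = i
    · subst hij; simp
    · rw [h.inner_eq_zero_of_ne hij]; simp [hij]
  | zero => exact inner_zero_left _
  | add y z _ _ hy hz => rw [inner_add_left, hy, hz, add_zero]
  | smul c y _ hy => rw [real_inner_smul_left, hy, mul_zero]

/-- The largest principal angle is the last one. -/
theorem isGreatest_last (h : IsPrincipalVectors P Q u v) (hk : 1 ≤ k) :
    IsGreatest (Set.range fun i => Real.arccos (inner ℝ (u i) (v i)))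
      (Real.arccos (inner ℝ (u ⟨k - 1, by omega⟩) (v ⟨k - 1, by omega⟩))) := by
  refine ⟨⟨_, rfl⟩, ?_⟩
  rintro _ ⟨i, rfl⟩
  exact Real.arccos_le_arccos (h.inner_antitone (Fin.le_def.2 (by have := i.2; simp; omega)))

end IsPrincipalVectors

/-- The Asimov distance is the angle between unit vectors `p ∈ P` and `q ∈ Q` which are, up to the
factor `⟪p, q⟫`, the orthogonal projections of each other. -/
theorem IsAsimovDistance.exists_pair {θ : ℝ} (h : IsAsimovDistance k P Q θ) (hk : 1 ≤ k)
    (hP : Module.finrank ℝ P = k) (hQ : Module.finrank ℝ Q = k) :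
    ∃ p ∈ P, ∃ q ∈ Q, ‖p‖ = 1 ∧ ‖q‖ = 1 ∧ 0 ≤ inner ℝ p q ∧ θ = Real.arccos (inner ℝ p q) ∧
      q - inner ℝ p q • p ∈ Pᗮ ∧ p - inner ℝ p q • q ∈ Qᗮ := by
  obtain ⟨u, v, huv, hθ⟩ := h
  set i : Fin k := ⟨k - 1, by omega⟩
  refine ⟨u i, (huv i).1.1, v i, (huv i).1.2.1, (huv i).1.2.2.1, (huv i).1.2.2.2.1,
    huv.inner_nonneg i, hθ.unique (huv.isGreatest_last hk), fun x hx => ?_, fun x hx => ?_⟩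
  · exact huv.inner_sub_eq_zero hP i hx
  · rw [real_inner_comm (v i)]
    exact huv.swap.inner_sub_eq_zero hQ i hx

theorem IsAsimovDistance.le_pi_div_two {θ : ℝ} (h : IsAsimovDistance k P Q θ) :
    θ ≤ Real.pi / 2 := by
  obtain ⟨u, v, huv, ⟨i, rfl⟩, -⟩ := h
  exact Real.arccos_le_pi_div_two.2 (huv.inner_nonneg i)

/-- A nonzero vector of `Q` orthogonal to `P` forces the last principal angle to be `π / 2`. -/
theorem isAsimovDistance_pi_div_two (hk : 1 ≤ k) (hP : Module.finrank ℝ P = k)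
    (hQ : Module.finrank ℝ Q = k) {y : EuclideanSpace ℝ (Fin d)} (hy : y ∈ Q) (hy0 : y ≠ 0)
    (hyP : y ∈ Pᗮ) : IsAsimovDistance k P Q (Real.pi / 2) := by
  obtain ⟨u, v, huv⟩ := exists_isPrincipalVectors hP hQ
  refine ⟨u, v, huv, ?_⟩
  have hsum : y = ∑ i, inner ℝ (v i) y • v i := by
    refine eq_sum_inner_of_mem_span_range huv.orthonormal_right ?_
    rwa [span_range_eq_of_orthonormal hQ huv.orthonormal_right fun i => (huv i).1.2.1]
  obtain ⟨i, hi⟩ : ∃ i, inner ℝ (v i) y ≠ 0 := by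
    by_contra! hall
    exact hy0 (by rw [hsum]; simp [hall])
  have hui : inner ℝ (u i) y = inner ℝ (v i) y * inner ℝ (u i) (v i) := by
    conv_lhs => rw [hsum]
    rw [inner_sum, Finset.sum_eq_single i]
    · rw [real_inner_smul_right]
    · intro j _ hj
      rw [real_inner_smul_right, huv.inner_eq_zero_of_ne hj.symm, mul_zero]
    · simp
  rw [hyP _ (huv i).1.1] at hui
  have hci : inner ℝ (u i) (v i) = 0 := (mul_eq_zero.1 hui.symm).resolve_left hi
  have hlast := huv.isGreatest_last hk
  have h0 : inner ℝ (u ⟨k - 1, by omega⟩) (v ⟨k - 1, by omega⟩) = 0 :=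
    le_antisymm (hci ▸ huv.inner_antitone (Fin.le_def.2 (by have := i.2; simp; omega)))
      (huv.inner_nonneg _)
  rwa [h0, Real.arccos_zero] at hlast

/-- Replacing the last vector of an orthonormal basis of `P` by a unit vector `q` orthogonal to the
others gives a subspace whose Asimov distance from `P` is the angle between the two vectors. -/
theorem isAsimovDistance_update_last (hk : 1 ≤ k) (hu : Orthonormal ℝ u)
    {q : EuclideanSpace ℝ (Fin d)}
    (hv : Orthonormal ℝ (Function.update u ⟨k - 1, by omega⟩ q))
    (h0 : 0 ≤ inner ℝ (u ⟨k - 1, by omega⟩) q) :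
    IsAsimovDistance k (Submodule.span ℝ (Set.range u))
      (Submodule.span ℝ (Set.range (Function.update u ⟨k - 1, by omega⟩ q)))
      (Real.arccos (inner ℝ (u ⟨k - 1, by omega⟩) q)) := by
  set i₀ : Fin k := ⟨k - 1, by omega⟩ with hi₀
  set v := Function.update u i₀ q with hvdef
  have hlast : ∀ i : Fin k, i ≠ i₀ → i < i₀ := fun i hi =>
    lt_of_le_of_ne (Fin.le_def.2 (by have := i.2; simp [hi₀]; omega)) hi
  have hvi : ∀ i, i ≠ i₀ → v i = u i := fun i hi => Function.update_of_ne hi _ _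
  have hv₀ : v i₀ = q := Function.update_self _ _ _
  refine ⟨u, v, fun i => ⟨⟨Submodule.subset_span ⟨i, rfl⟩, Submodule.subset_span ⟨i, rfl⟩, hu.1 i,
    hv.1 i, fun j hj => ⟨hu.2 hj.ne, hv.2 hj.ne⟩⟩, fun x y hxy => ?_⟩, ?_⟩
  · obtain ⟨hx, hy, hx1, hy1, hxy0⟩ := hxy
    by_cases hi : i = i₀
    · subst hi
      have hx' : x = inner ℝ (u i₀) x • u i₀ := by
        conv_lhs => rw [eq_sum_inner_of_mem_span_range hu hx]
        refine Finset.sum_eq_single i₀ (fun j _ hj => ?_) (by simp)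
        rw [(hxy0 j (hlast j hj)).1, zero_smul]
      have hy' : y = inner ℝ (v i₀) y • v i₀ := by
        conv_lhs => rw [eq_sum_inner_of_mem_span_range hv hy]
        refine Finset.sum_eq_single i₀ (fun j _ hj => ?_) (by simp)
        rw [(hxy0 j (hlast j hj)).2, zero_smul]
      have hα : |inner ℝ (u i₀) x| ≤ 1 := by
        simpa [hu.1 i₀, hx1] using abs_real_inner_le_norm (u i₀) x
      have hβ : |inner ℝ (v i₀) y| ≤ 1 := by
        simpa [hv.1 i₀, hy1] using abs_real_inner_le_norm (v i₀) y
      have hαβ : inner ℝ (u i₀) x * inner ℝ (v i₀) y ≤ 1 := by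
        refine (le_abs_self _).trans ?_
        rw [abs_mul]
        exact mul_le_one₀ hα (abs_nonneg _) hβ
      rw [hx', hy', real_inner_smul_left, real_inner_smul_right, ← mul_assoc]
      rw [← hv₀] at h0
      exact mul_le_of_le_one_left h0 hαβ
    · rw [hvi i hi, real_inner_self_eq_norm_sq, hu.1 i]
      have := real_inner_le_norm x y
      rw [hx1, hy1] at this
      simpa using this
  · refine ⟨⟨i₀, by simp only [hv₀]⟩, ?_⟩
    rintro _ ⟨i, rfl⟩
    by_cases hi : i = i₀
    · subst hi; simp only [hv₀]; exact le_rfl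
    · simp only [hvi i hi, real_inner_self_eq_norm_sq, hu.1 i]
      simpa using Real.arccos_nonneg _

end Asimov

/-! ### Lower bounds for the energy of a perturbation -/

section LowerBound

variable {d n k : ℕ}

theorem norm_sq_add_norm_sq_le (D : Matrix (Fin d) (Fin n) ℝ) {g₁ g₂ : EuclideanSpace ℝ (Fin d)}
    (h₁ : ‖g₁‖ = 1) (h₂ : ‖g₂‖ = 1) (h₁₂ : inner ℝ g₁ g₂ = 0) :
    ‖Matrix.toEuclideanLin Dᵀ g₁‖ ^ 2 + ‖Matrix.toEuclideanLin Dᵀ g₂‖ ^ 2 ≤ ‖D‖ ^ 2 := by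
  have hon : Orthonormal ℝ ![g₁, g₂] := by
    rw [orthonormal_iff_ite]
    have h₂₁ : inner ℝ g₂ g₁ = 0 := (real_inner_comm _ _).trans h₁₂
    intro i j
    fin_cases i <;> fin_cases j <;> simp [h₁, h₂, h₁₂, h₂₁]
  let col : Fin n → EuclideanSpace ℝ (Fin d) := fun j => WithLp.toLp 2 fun i => D i j
  have hcoord : ∀ g : EuclideanSpace ℝ (Fin d),
      ‖Matrix.toEuclideanLin Dᵀ g‖ ^ 2 = ∑ j, ‖inner ℝ g (col j)‖ ^ 2 := by
    intro g
    rw [EuclideanSpace.norm_sq_eq]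
    refine Finset.sum_congr rfl fun j _ => ?_
    simp [Matrix.toEuclideanLin, Matrix.toLpLin_apply, Matrix.mulVec, dotProduct, col,
      PiLp.inner_apply]
  rw [hcoord, hcoord, ← Finset.sum_add_distrib, norm_sq_eq_sum_sq, Finset.sum_comm]
  refine Finset.sum_le_sum fun j _ => ?_
  have hb := hon.sum_inner_products_le (x := col j) (s := Finset.univ)
  rw [Fin.sum_univ_two, EuclideanSpace.norm_sq_eq] at hb
  simpa [col] using hb

/-- If `Xᵀ` stretches `g₁` by at least `A` and `g₂` by at most `B ≤ A`, but `(X + D)ᵀ` stretches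
`g₁` no more than `g₂`, then `D` makes up for the gap `A - B` in these two directions. -/
theorem sub_sq_le_two_mul_norm_sq (X D : Matrix (Fin d) (Fin n) ℝ)
    {g₁ g₂ : EuclideanSpace ℝ (Fin d)} (h₁ : ‖g₁‖ = 1) (h₂ : ‖g₂‖ = 1) (h₁₂ : inner ℝ g₁ g₂ = 0)
    {A B : ℝ} (hBA : B ≤ A) (hA : A ≤ ‖Matrix.toEuclideanLin Xᵀ g₁‖)
    (hB : ‖Matrix.toEuclideanLin Xᵀ g₂‖ ≤ B)
    (hY : ‖Matrix.toEuclideanLin (X + D)ᵀ g₁‖ ≤ ‖Matrix.toEuclideanLin (X + D)ᵀ g₂‖) :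
    (A - B) ^ 2 ≤ 2 * ‖D‖ ^ 2 := by
  have hD := norm_sq_add_norm_sq_le D h₁ h₂ h₁₂
  have hadd : ∀ g, Matrix.toEuclideanLin (X + D)ᵀ g =
      Matrix.toEuclideanLin Xᵀ g + Matrix.toEuclideanLin Dᵀ g := fun g => by
    rw [Matrix.transpose_add, map_add, LinearMap.add_apply]
  rw [hadd, hadd] at hY
  have h3 := norm_sub_norm_le (Matrix.toEuclideanLin Xᵀ g₁) (-Matrix.toEuclideanLin Dᵀ g₁)
  have h4 := norm_add_le (Matrix.toEuclideanLin Xᵀ g₂) (Matrix.toEuclideanLin Dᵀ g₂)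
  rw [norm_neg, sub_neg_eq_add] at h3
  have h5 : A - B ≤ ‖Matrix.toEuclideanLin Dᵀ g₁‖ + ‖Matrix.toEuclideanLin Dᵀ g₂‖ := by linarith
  nlinarith [sq_nonneg (‖Matrix.toEuclideanLin Dᵀ g₁‖ - ‖Matrix.toEuclideanLin Dᵀ g₂‖)]

theorem sqrt_sub_sqrt_mono {p r x x₀ y : ℝ} (hr : 0 ≤ r) (hrp : r ≤ p) (hx₀ : 0 ≤ x₀)
    (hx : x₀ ≤ x) (hy : 0 ≤ y) :
    √(r * x + p * y) - √(r * x₀ + p * y) ≤ √(p * x + r * y) - √(p * x₀ + r * y) := by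
  have hp : 0 ≤ p := hr.trans hrp
  have hx' : 0 ≤ x := hx₀.trans hx
  rcases hx.eq_or_lt with rfl | hlt
  · simp
  rcases hp.eq_or_lt with rfl | hp0
  · have : r = 0 := le_antisymm hrp hr
    simp [this]
  have hcomp : ∀ t, 0 ≤ t → r * √(p * t + r * y) ≤ p * √(r * t + p * y) := by
    intro t ht
    refine (pow_le_pow_iff_left₀ (by positivity) (by positivity) two_ne_zero).1 ?_
    rw [mul_pow, mul_pow, Real.sq_sqrt (by positivity), Real.sq_sqrt (by positivity)]
    have h1 : 0 ≤ p * r * t * (p - r) :=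
      mul_nonneg (mul_nonneg (mul_nonneg hp hr) ht) (sub_nonneg.2 hrp)
    have h2 : 0 ≤ (p ^ 3 - r ^ 3) * y :=
      mul_nonneg (sub_nonneg.2 (pow_le_pow_left₀ hr hrp 3)) hy
    nlinarith
  have e1 := Real.sq_sqrt (show 0 ≤ p * x + r * y by positivity)
  have e2 := Real.sq_sqrt (show 0 ≤ p * x₀ + r * y by positivity)
  have e3 := Real.sq_sqrt (show 0 ≤ r * x + p * y by positivity)
  have e4 := Real.sq_sqrt (show 0 ≤ r * x₀ + p * y by positivity)
  have hN : 0 < √(p * x + r * y) :=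
    Real.sqrt_pos.2 (add_pos_of_pos_of_nonneg (mul_pos hp0 (hx₀.trans_lt hlt)) (mul_nonneg hr hy))
  have c1 := hcomp x hx'
  have c2 := hcomp x₀ hx₀
  set N₁ := √(p * x + r * y)
  set n₁ := √(p * x₀ + r * y)
  set N₂ := √(r * x + p * y)
  set n₂ := √(r * x₀ + p * y)
  have hn₁ : 0 ≤ n₁ := Real.sqrt_nonneg _
  have hN₂ : 0 ≤ N₂ := Real.sqrt_nonneg _
  have hn₂ : 0 ≤ n₂ := Real.sqrt_nonneg _
  rcases (add_nonneg hN₂ hn₂).eq_or_lt with h0 | h0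
  · have : n₁ ≤ N₁ := Real.sqrt_le_sqrt (by nlinarith)
    linarith
  · -- both differences of roots are `(x - x₀) * coefficient / sum of roots`
    by_contra! hcon
    have h1 : (N₁ - n₁) * (N₁ + n₁) = p * (x - x₀) := by nlinarith
    have h2 : (N₂ - n₂) * (N₂ + n₂) = r * (x - x₀) := by nlinarith
    have h3 : r * (x - x₀) * (N₁ + n₁) ≤ p * (x - x₀) * (N₂ + n₂) := by
      nlinarith [mul_le_mul_of_nonneg_right (add_le_add c1 c2) (sub_nonneg.2 hx)]
    rw [← h1, ← h2] at h3
    have hs : 0 < (N₁ + n₁) * (N₂ + n₂) := mul_pos (by linarith) h0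
    nlinarith [mul_lt_mul_of_pos_right hcon hs]

/-- The difference of the lengths of the rows of a rotated `diag(α, β)` grows with `α` and
decreases with `β`. -/
theorem sqrt_sub_sqrt_le {p r a b α β : ℝ} (hr : 0 ≤ r) (hrp : r ≤ p) (hβ : 0 ≤ β) (hβb : β ≤ b)
    (ha : 0 ≤ a) (haα : a ≤ α) :
    √(p * a + r * b) - √(r * a + p * b) ≤ √(p * α + r * β) - √(r * α + p * β) := by
  have h1 := sqrt_sub_sqrt_mono (y := b) hr hrp ha haα (hβ.trans hβb)
  have h2 := sqrt_sub_sqrt_mono (y := α) hr hrp hβ hβb (ha.trans haα)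
  rw [add_comm (r * b), add_comm (r * β), add_comm (p * b), add_comm (p * β)] at h2
  linarith

theorem norm_sq_map_add_of_orthogonal {E F : Type*} [NormedAddCommGroup E] [InnerProductSpace ℝ E]
    [NormedAddCommGroup F] [InnerProductSpace ℝ F] (L : E →ₗ[ℝ] F) {x y : E}
    (h : inner ℝ (L x) (L y) = 0) (s t : ℝ) :
    ‖L (s • x + t • y)‖ ^ 2 = s ^ 2 * ‖L x‖ ^ 2 + t ^ 2 * ‖L y‖ ^ 2 := by
  rw [map_add, map_smul, map_smul, norm_add_sq_real, real_inner_smul_left,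
    real_inner_smul_right, h, norm_smul, norm_smul, mul_pow, mul_pow, Real.norm_eq_abs,
    Real.norm_eq_abs, sq_abs, sq_abs]
  ring

/-- The plane of a pair of principal vectors `p`, `q` at the angle with cosine `c` and sine `s` has
the orthonormal bases `p, p'` and `q, q'` with `p' ∈ Pᗮ` and `q' ∈ Qᗮ`. -/
theorem exists_principal_plane {E : Type*} [NormedAddCommGroup E] [InnerProductSpace ℝ E]
    {P Q : Submodule ℝ E} {p q : E} (hp1 : ‖p‖ = 1) (hq1 : ‖q‖ = 1)
    {c s : ℝ} (hc : inner ℝ p q = c) (hs0 : 0 < s) (hcs : c ^ 2 + s ^ 2 = 1)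
    (hpq : q - c • p ∈ Pᗮ) (hqp : p - c • q ∈ Qᗮ) :
    ∃ p' ∈ Pᗮ, ∃ q' ∈ Qᗮ, ‖p'‖ = 1 ∧ ‖q'‖ = 1 ∧ q = c • p + s • p' ∧ q' = s • p + (-c) • p' ∧
      p = c • q + s • q' ∧ p' = s • q + (-c) • q' := by
  have hpp : inner ℝ p p = 1 := by rw [real_inner_self_eq_norm_sq, hp1, one_pow]
  have hqq : inner ℝ q q = 1 := by rw [real_inner_self_eq_norm_sq, hq1, one_pow]
  have hqp' : inner ℝ q p = c := (real_inner_comm _ _).trans hc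
  have hs1 : s * s⁻¹ = 1 := mul_inv_cancel₀ hs0.ne'
  have e1 : q = c • p + s • (s⁻¹ • (q - c • p)) := by
    rw [smul_smul, hs1, one_smul]; abel
  have e2 : p = c • q + s • (s⁻¹ • (p - c • q)) := by
    rw [smul_smul, hs1, one_smul]; abel
  have key : ∀ {x y x' y' : E}, y = c • x + s • x' → x = c • y + s • y' →
      y' = s • x + (-c) • x' := by
    intro x y x' y' h1 h2
    have h3 : s • y' = s • (s • x + (-c) • x') := by
      have h4 : s • y' = x - c • y := by nth_rewrite 1 [h2]; abel
      have h5 : x = (c ^ 2 + s ^ 2) • x := by rw [hcs, one_smul]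
      rw [h4, h1]
      nth_rewrite 1 [h5]
      module
    exact smul_right_injective E hs0.ne' h3
  refine ⟨s⁻¹ • (q - c • p), Submodule.smul_mem _ _ hpq, s⁻¹ • (p - c • q),
    Submodule.smul_mem _ _ hqp, ?_, ?_, e1, key e1 e2, e2, key e2 e1⟩
  · rw [← pow_left_inj₀ (norm_nonneg _) zero_le_one two_ne_zero, ← real_inner_self_eq_norm_sq]
    simp only [real_inner_smul_left, real_inner_smul_right, inner_sub_left, inner_sub_right, hpp,
      hqq, hc, hqp']
    field_simp
    linarith
  · rw [← pow_left_inj₀ (norm_nonneg _) zero_le_one two_ne_zero, ← real_inner_self_eq_norm_sq]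
    simp only [real_inner_smul_left, real_inner_smul_right, inner_sub_left, inner_sub_right, hpp,
      hqq, hc, hqp']
    field_simp
    linarith

/-- If `q` makes an angle of at least `π / 4` with `p`, then `Yᵀ` stretches `p` at most as much as
`p'`, whereas `Xᵀ` stretches them by at least `a` and at most `b`. -/
theorem energy_bound_of_cos_le_sin {X D : Matrix (Fin d) (Fin n) ℝ} {a b c s : ℝ} (hba : b ≤ a)
    {p p' q q' : EuclideanSpace ℝ (Fin d)} (hp1 : ‖p‖ = 1) (hp'1 : ‖p'‖ = 1)
    (hpp' : inner ℝ p p' = 0) (ep : p = c • q + s • q') (ep' : p' = s • q + (-c) • q')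
    (hXa : a ≤ ‖Matrix.toEuclideanLin Xᵀ p‖) (hXb : ‖Matrix.toEuclideanLin Xᵀ p'‖ ≤ b)
    (hY1 : ‖Matrix.toEuclideanLin (X + D)ᵀ q'‖ ^ 2 ≤ ‖Matrix.toEuclideanLin (X + D)ᵀ q‖ ^ 2)
    (hY0 : inner ℝ (Matrix.toEuclideanLin (X + D)ᵀ q) (Matrix.toEuclideanLin (X + D)ᵀ q') = 0)
    (hc0 : 0 ≤ c) (hcs : c ≤ s) : (a - b) ^ 2 ≤ 2 * ‖D‖ ^ 2 := by
  refine sub_sq_le_two_mul_norm_sq X D hp1 hp'1 hpp' hba hXa hXb ?_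
  refine (pow_le_pow_iff_left₀ (norm_nonneg _) (norm_nonneg _) two_ne_zero).1 ?_
  rw [ep, ep', norm_sq_map_add_of_orthogonal _ hY0, norm_sq_map_add_of_orthogonal _ hY0]
  have : c ^ 2 ≤ s ^ 2 := pow_le_pow_left₀ hc0 hcs 2
  nlinarith [mul_le_mul_of_nonneg_left hY1 (sub_nonneg.2 this)]

/-- The diagonals `(q ± q') / √2` are stretched equally by `Yᵀ`. The lengths of their images under
`Xᵀ` are those of the rows of a rotated diagonal matrix. -/
theorem energy_bound_of_diagonals {X D : Matrix (Fin d) (Fin n) ℝ} {a b c s : ℝ}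
    (hb : 0 ≤ b) (hba : b ≤ a)
    {p p' q q' : EuclideanSpace ℝ (Fin d)} (hq1 : ‖q‖ = 1) (hq'1 : ‖q'‖ = 1)
    (hqq' : inner ℝ q q' = 0) (eq : q = c • p + s • p') (eq' : q' = s • p + (-c) • p')
    (hXa : a ^ 2 ≤ ‖Matrix.toEuclideanLin Xᵀ p‖ ^ 2)
    (hXb : ‖Matrix.toEuclideanLin Xᵀ p'‖ ^ 2 ≤ b ^ 2)
    (hX0 : inner ℝ (Matrix.toEuclideanLin Xᵀ p) (Matrix.toEuclideanLin Xᵀ p') = 0)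
    (hY0 : inner ℝ (Matrix.toEuclideanLin (X + D)ᵀ q) (Matrix.toEuclideanLin (X + D)ᵀ q') = 0)
    (hc0 : 0 ≤ c) (hs0 : 0 ≤ s) (hcs : c ^ 2 + s ^ 2 = 1) :
    (√((1 + 2 * (c * s)) / 2 * a ^ 2 + (1 - 2 * (c * s)) / 2 * b ^ 2) -
        √((1 - 2 * (c * s)) / 2 * a ^ 2 + (1 + 2 * (c * s)) / 2 * b ^ 2)) ^ 2 ≤ 2 * ‖D‖ ^ 2 := by
  set h : ℝ := (√2)⁻¹ with hh
  have hh2 : h ^ 2 = 1 / 2 := by rw [hh, inv_pow, Real.sq_sqrt zero_le_two]; norm_num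
  clear_value h
  have hL : ∀ t : ℝ, t ^ 2 = 1 / 2 → ‖h • q + t • q'‖ = 1 := by
    intro t ht
    have := norm_sq_map_add_of_orthogonal (LinearMap.id : EuclideanSpace ℝ (Fin d) →ₗ[ℝ] _)
      (x := q) (y := q') hqq' h t
    simp only [LinearMap.id_apply, hq1, hq'1, hh2, ht] at this
    rw [← pow_left_inj₀ (norm_nonneg _) zero_le_one two_ne_zero, this]
    norm_num
  have n12 : inner ℝ (h • q + h • q') (h • q + (-h) • q') = 0 := by
    have hq'q : inner ℝ q' q = 0 := (real_inner_comm _ _).trans hqq'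
    have h1 : inner ℝ q q = 1 := by rw [real_inner_self_eq_norm_sq, hq1, one_pow]
    have h2 : inner ℝ q' q' = 1 := by rw [real_inner_self_eq_norm_sq, hq'1, one_pow]
    simp only [inner_add_left, inner_add_right, real_inner_smul_left, real_inner_smul_right, hqq',
      hq'q, h1, h2]
    ring
  have g1 : h • q + h • q' = (h * (c + s)) • p + (h * (s - c)) • p' := by
    rw [eq', eq]; module
  have g2 : h • q + (-h) • q' = (h * (c - s)) • p + (h * (s + c)) • p' := by
    rw [eq', eq]; module
  have sq1 : (h * (c + s)) ^ 2 = (1 + 2 * (c * s)) / 2 := by rw [mul_pow, hh2]; linarith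
  have sq2 : (h * (s - c)) ^ 2 = (1 - 2 * (c * s)) / 2 := by rw [mul_pow, hh2]; linarith
  have sq3 : (h * (c - s)) ^ 2 = (1 - 2 * (c * s)) / 2 := by rw [mul_pow, hh2]; linarith
  have sq4 : (h * (s + c)) ^ 2 = (1 + 2 * (c * s)) / 2 := by rw [mul_pow, hh2]; linarith
  have N1 := norm_sq_map_add_of_orthogonal _ hX0 (h * (c + s)) (h * (s - c))
  have N2 := norm_sq_map_add_of_orthogonal _ hX0 (h * (c - s)) (h * (s + c))
  rw [← g1, sq1, sq2] at N1
  rw [← g2, sq3, sq4] at N2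
  have hcs0 : 0 ≤ c * s := mul_nonneg hc0 hs0
  have hr0 : 0 ≤ (1 - 2 * (c * s)) / 2 := by nlinarith [sq_nonneg (c - s)]
  have hle := sqrt_sub_sqrt_le hr0 (by linarith : (1 - 2 * (c * s)) / 2 ≤ (1 + 2 * (c * s)) / 2)
    (sq_nonneg _) hXb (sq_nonneg a) hXa
  rw [← N1, ← N2, Real.sqrt_sq (norm_nonneg _), Real.sqrt_sq (norm_nonneg _)] at hle
  have hpos : 0 ≤ √((1 + 2 * (c * s)) / 2 * a ^ 2 + (1 - 2 * (c * s)) / 2 * b ^ 2) -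
      √((1 - 2 * (c * s)) / 2 * a ^ 2 + (1 + 2 * (c * s)) / 2 * b ^ 2) := by
    rw [sub_nonneg]
    refine Real.sqrt_le_sqrt ?_
    have h1 : b ^ 2 ≤ a ^ 2 := pow_le_pow_left₀ hb hba 2
    nlinarith [mul_nonneg hcs0 (sub_nonneg.2 h1)]
  refine (pow_le_pow_left₀ hpos hle 2).trans ?_
  refine sub_sq_le_two_mul_norm_sq X D (hL h hh2) (hL (-h) (by rw [neg_sq, hh2])) n12
    (by linarith) le_rfl le_rfl ?_
  refine (pow_le_pow_iff_left₀ (norm_nonneg _) (norm_nonneg _) two_ne_zero).1 (le_of_eq ?_)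
  rw [norm_sq_map_add_of_orthogonal _ hY0, norm_sq_map_add_of_orthogonal _ hY0, neg_sq]

end LowerBound

/-! ### The closed forms of the optimal attack -/

section ClosedForms

variable {a b η : ℝ}

theorem two_mul_sq_lt (hη : 0 ≤ η) (h : η < (a - b) / √2) : 2 * η ^ 2 < (a - b) ^ 2 := by
  have h1 := pow_lt_pow_left₀ h hη two_ne_zero
  rw [div_pow, Real.sq_sqrt zero_le_two] at h1
  linarith

theorem lt_of_lt_gap (hη : 0 ≤ η) (h : η < (a - b) / √2) : b < a := by
  have h1 := hη.trans_lt h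
  rw [div_pos_iff_of_pos_right (by positivity)] at h1
  linarith

theorem mul_lt_attackC (hη : 0 ≤ η) (h : η < (a - b) / √2) : a * b < attackC a b η := by
  have := two_mul_sq_lt hη h
  unfold attackC
  nlinarith

theorem attackW_pos (hb : 0 ≤ b) (hη : 0 ≤ η) (h : η < (a - b) / √2) : 0 < attackW a b η := by
  have hba := lt_of_lt_gap hη h
  have hc := mul_lt_attackC hη h
  have hab : 0 ≤ a * b := mul_nonneg (hb.trans hba.le) hb
  unfold attackW
  have h1 : 0 < a ^ 2 - b ^ 2 := by nlinarith
  have h2 : 0 < attackC a b η ^ 2 - a ^ 2 * b ^ 2 := by nlinarith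
  positivity

theorem attackW_mul (hb : 0 ≤ b) (hη : 0 ≤ η) (h : η < (a - b) / √2) :
    attackW a b η * (a ^ 2 - b ^ 2) ^ 2 = attackC a b η ^ 2 - a ^ 2 * b ^ 2 := by
  have hba := lt_of_lt_gap hη h
  unfold attackW
  have h1 : a ^ 2 - b ^ 2 ≠ 0 := by nlinarith
  field_simp

theorem attackW_le (hb : 0 ≤ b) (hη : 0 ≤ η) (h : η < (a - b) / √2) :
    attackW a b η ≤ 1 / 4 := by
  have hba := lt_of_lt_gap hη h
  have hc := mul_lt_attackC hη h
  have hab : 0 ≤ a * b := mul_nonneg (hb.trans hba.le) hb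
  have h1 : 0 < a ^ 2 - b ^ 2 := by nlinarith
  unfold attackW
  rw [div_le_iff₀ (by positivity)]
  have h2 : attackC a b η ≤ (a ^ 2 + b ^ 2) / 2 := by unfold attackC; nlinarith
  nlinarith

/-- The sine `√(1 - 4 w)` of twice the optimal angle. -/
def attackSin (a b η : ℝ) : ℝ := √(1 - 4 * attackW a b η)

theorem attackSin_nonneg : 0 ≤ attackSin a b η := Real.sqrt_nonneg _

theorem attackSin_sq (hb : 0 ≤ b) (hη : 0 ≤ η) (h : η < (a - b) / √2) :
    attackSin a b η ^ 2 = 1 - 4 * attackW a b η :=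
  Real.sq_sqrt (by linarith [attackW_le hb hη h])

theorem attackSin_lt_one (hb : 0 ≤ b) (hη : 0 ≤ η) (h : η < (a - b) / √2) :
    attackSin a b η < 1 := by
  have h1 := attackSin_sq hb hη h
  have h2 := attackW_pos hb hη h
  have h3 := attackSin_nonneg (a := a) (b := b) (η := η)
  nlinarith

theorem attackE_sq (hb : 0 ≤ b) (hη : 0 ≤ η) (h : η < (a - b) / √2) :
    attackE a b η ^ 2 = (1 + attackSin a b η) / (1 - attackSin a b η) := by
  have h1 := attackSin_lt_one hb hη h
  have h2 := attackSin_nonneg (a := a) (b := b) (η := η)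
  unfold attackE
  rw [Real.sq_sqrt]
  · rfl
  · exact div_nonneg (add_nonneg zero_le_one h2) (sub_nonneg.2 h1.le)

theorem attackE_pos (hb : 0 ≤ b) (hη : 0 ≤ η) (h : η < (a - b) / √2) : 0 < attackE a b η := by
  have h1 := attackSin_lt_one hb hη h
  have h2 := attackSin_nonneg (a := a) (b := b) (η := η)
  unfold attackE
  exact Real.sqrt_pos.2 (div_pos (by unfold attackSin at h2; linarith)
    (by unfold attackSin at h1; linarith))

theorem sqrt_attackLambda (hb : 0 ≤ b) (hη : 0 ≤ η) (h : η < (a - b) / √2) :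
    √(attackLambda a b η ^ 2 + 1) = (attackE a b η ^ 2 + 1) / (2 * attackE a b η) := by
  have he := attackE_pos hb hη h
  rw [Real.sqrt_eq_iff_eq_sq (by positivity) (by positivity)]
  unfold attackLambda
  field_simp
  ring

theorem attackM_eq (hb : 0 ≤ b) (hη : 0 ≤ η) (h : η < (a - b) / √2) :
    attackM a b η = attackE a b η := by
  have he := attackE_pos hb hη h
  unfold attackM
  rw [sqrt_attackLambda hb hη h]
  unfold attackLambda
  field_simp
  ring

theorem attackE_sq_add_one (hb : 0 ≤ b) (hη : 0 ≤ η) (h : η < (a - b) / √2) :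
    attackE a b η ^ 2 + 1 = 2 / (1 - attackSin a b η) := by
  have h1 : 1 - attackSin a b η ≠ 0 := (sub_pos.2 (attackSin_lt_one hb hη h)).ne'
  rw [attackE_sq hb hη h]
  field_simp
  ring

theorem attackP11_sq (hb : 0 ≤ b) (hη : 0 ≤ η) (h : η < (a - b) / √2) :
    attackP11 a b η ^ 2 = (1 - attackSin a b η) / 2 := by
  unfold attackP11
  rw [div_pow, Real.sq_sqrt (by positivity), attackM_eq hb hη h, attackE_sq_add_one hb hη h]
  simp

theorem attackP21_sq (hb : 0 ≤ b) (hη : 0 ≤ η) (h : η < (a - b) / √2) :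
    attackP21 a b η ^ 2 = (1 + attackSin a b η) / 2 := by
  have h1 : 1 - attackSin a b η ≠ 0 := (sub_pos.2 (attackSin_lt_one hb hη h)).ne'
  unfold attackP21
  rw [div_pow, Real.sq_sqrt (by positivity), attackM_eq hb hη h, attackE_sq_add_one hb hη h,
    attackE_sq hb hη h]
  field_simp

theorem attackP11_pos : 0 < attackP11 a b η := by
  unfold attackP11; positivity

theorem attackP21_pos (hb : 0 ≤ b) (hη : 0 ≤ η) (h : η < (a - b) / √2) :
    0 < attackP21 a b η := by
  have := attackE_pos hb hη h
  rw [← attackM_eq hb hη h] at this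
  unfold attackP21; positivity

theorem attackP_sq_add_sq (hb : 0 ≤ b) (hη : 0 ≤ η) (h : η < (a - b) / √2) :
    attackP11 a b η ^ 2 + attackP21 a b η ^ 2 = 1 := by
  rw [attackP11_sq hb hη h, attackP21_sq hb hη h]; ring

theorem attackP_mul_sq (hb : 0 ≤ b) (hη : 0 ≤ η) (h : η < (a - b) / √2) :
    (attackP11 a b η * attackP21 a b η) ^ 2 = attackW a b η := by
  have h1 := attackSin_sq hb hη h
  rw [mul_pow, attackP11_sq hb hη h, attackP21_sq hb hη h]
  linarith

theorem attackA_pos (hb : 0 ≤ b) (hη : 0 ≤ η) (h : η < (a - b) / √2) : 0 < attackA a b η := by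
  have h1 := attackP11_pos (a := a) (b := b) (η := η)
  have h2 : 0 < a := hb.trans_lt (lt_of_lt_gap hη h)
  unfold attackA; positivity

theorem attackA'_pos (hb : 0 ≤ b) (hη : 0 ≤ η) (h : η < (a - b) / √2) : 0 < attackA' a b η := by
  have h1 := attackP21_pos hb hη h
  have h2 : 0 < a := hb.trans_lt (lt_of_lt_gap hη h)
  unfold attackA'; positivity

theorem attackA_sq : attackA a b η ^ 2 =
    attackP11 a b η ^ 2 * a ^ 2 + attackP21 a b η ^ 2 * b ^ 2 :=
  Real.sq_sqrt (by positivity)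

theorem attackA'_sq : attackA' a b η ^ 2 =
    attackP21 a b η ^ 2 * a ^ 2 + attackP11 a b η ^ 2 * b ^ 2 :=
  Real.sq_sqrt (by positivity)

/-- The angle is chosen such that the rows of the rotated `diag(a, b)` have the product `c` of
lengths, which makes the energy of the attack equal to `η ^ 2`. -/
theorem attackA_mul_attackA' (hb : 0 ≤ b) (hη : 0 ≤ η) (h : η < (a - b) / √2) :
    attackA a b η * attackA' a b η = attackC a b η := by
  have hba := lt_of_lt_gap hη h
  have hab : 0 ≤ a * b := mul_nonneg (hb.trans hba.le) hb
  have h0 : 0 ≤ attackC a b η := hab.trans (mul_lt_attackC hη h).le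
  refine (pow_left_inj₀ (mul_pos (attackA_pos hb hη h) (attackA'_pos hb hη h)).le h0
    two_ne_zero).1 ?_
  have h1 := attackW_mul hb hη h
  rw [← attackP_mul_sq hb hη h] at h1
  have h2 := attackP_sq_add_sq hb hη h
  rw [mul_pow, attackA_sq, attackA'_sq]
  have h3 : attackC a b η ^ 2 = (attackP11 a b η * attackP21 a b η) ^ 2 * (a ^ 2 - b ^ 2) ^ 2 +
      a ^ 2 * b ^ 2 * (attackP11 a b η ^ 2 + attackP21 a b η ^ 2) ^ 2 := by
    rw [h2]; linarith
  rw [h3]; ring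

theorem attackA_sq_add_sq (hb : 0 ≤ b) (hη : 0 ≤ η) (h : η < (a - b) / √2) :
    attackA a b η ^ 2 + attackA' a b η ^ 2 = a ^ 2 + b ^ 2 := by
  rw [attackA_sq, attackA'_sq]
  linear_combination (a ^ 2 + b ^ 2) * attackP_sq_add_sq hb hη h

theorem attackLambda_nonneg (hb : 0 ≤ b) (hη : 0 ≤ η) (h : η < (a - b) / √2) :
    0 ≤ attackLambda a b η := by
  have he := attackE_pos hb hη h
  have h1 := attackSin_lt_one hb hη h
  have h2 := attackSin_nonneg (a := a) (b := b) (η := η)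
  have h3 : 1 ≤ attackE a b η ^ 2 := by
    rw [attackE_sq hb hη h, one_le_div (sub_pos.2 h1)]; linarith
  unfold attackLambda
  exact div_nonneg (sub_nonneg.2 h3) (by positivity)

theorem attackTheta_nonneg (hb : 0 ≤ b) (hη : 0 ≤ η) (h : η < (a - b) / √2) :
    0 ≤ attackTheta a b η := by
  have := Real.arctan_nonneg.2 (attackLambda_nonneg hb hη h)
  unfold attackTheta; linarith

theorem two_mul_attackTheta : 2 * attackTheta a b η = Real.arctan (attackLambda a b η) := by
  unfold attackTheta; ring

theorem attackTheta_lt : attackTheta a b η < Real.pi / 4 := by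
  have := Real.arctan_lt_pi_div_two (attackLambda a b η)
  unfold attackTheta; linarith

theorem sin_two_mul_attackTheta (hb : 0 ≤ b) (hη : 0 ≤ η) (h : η < (a - b) / √2) :
    Real.sin (2 * attackTheta a b η) = attackSin a b η := by
  have he := attackE_pos hb hη h
  have h1 : 1 - attackSin a b η ≠ 0 := (sub_pos.2 (attackSin_lt_one hb hη h)).ne'
  have h2 : attackLambda a b η / √(1 + attackLambda a b η ^ 2) =
      (attackE a b η ^ 2 - 1) / (attackE a b η ^ 2 + 1) := by
    rw [add_comm, sqrt_attackLambda hb hη h]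
    unfold attackLambda
    field_simp
  rw [two_mul_attackTheta, Real.sin_arctan, h2, attackE_sq_add_one hb hη h, attackE_sq hb hη h]
  field_simp
  ring

theorem cos_two_mul_attackTheta (hb : 0 ≤ b) (hη : 0 ≤ η) (h : η < (a - b) / √2) :
    Real.cos (2 * attackTheta a b η) = 2 * (attackP11 a b η * attackP21 a b η) := by
  have hc : 0 ≤ Real.cos (2 * attackTheta a b η) := by
    rw [two_mul_attackTheta]; exact (Real.cos_arctan_pos _).le
  refine (pow_left_inj₀ hc (mul_nonneg zero_le_two
    (mul_pos attackP11_pos (attackP21_pos hb hη h)).le) two_ne_zero).1 ?_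
  rw [Real.cos_sq', sin_two_mul_attackTheta hb hη h, attackSin_sq hb hη h, mul_pow,
    attackP_mul_sq hb hη h]
  ring

/-- The optimal angle is the angle of `(p₁, p₂)` and the diagonal `(1, 1)`. -/
theorem cos_attackTheta (hb : 0 ≤ b) (hη : 0 ≤ η) (h : η < (a - b) / √2) :
    Real.cos (attackTheta a b η) = (attackP11 a b η + attackP21 a b η) / √2 := by
  have h1 := attackTheta_nonneg hb hη h
  have h2 := attackTheta_lt (a := a) (b := b) (η := η)
  have hc : 0 ≤ Real.cos (attackTheta a b η) :=
    Real.cos_nonneg_of_mem_Icc ⟨by linarith [Real.pi_pos], by linarith [Real.pi_pos]⟩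
  have hp := attackP11_pos (a := a) (b := b) (η := η)
  have hp' := attackP21_pos hb hη h
  refine (pow_left_inj₀ hc (by positivity) two_ne_zero).1 ?_
  have h3 := Real.cos_two_mul (attackTheta a b η)
  rw [cos_two_mul_attackTheta hb hη h] at h3
  rw [div_pow, Real.sq_sqrt zero_le_two]
  nlinarith [attackP_sq_add_sq hb hη h]

theorem arccos_eq_attackTheta (hb : 0 ≤ b) (hη : 0 ≤ η) (h : η < (a - b) / √2) :
    Real.arccos ((attackP11 a b η + attackP21 a b η) / √2) = attackTheta a b η := by
  rw [← cos_attackTheta hb hη h, Real.arccos_cos (attackTheta_nonneg hb hη h)]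
  linarith [attackTheta_lt (a := a) (b := b) (η := η), Real.pi_pos]

/-- For `σ = sin (2 θ)` with `θ ≤ π / 4`, the left-hand side of `hle` is twice the least energy
which turns the leading left singular vector of `diag(a, b)` by the angle `θ`. -/
theorem le_attackSin {σ : ℝ} (hb : 0 ≤ b) (hη : 0 ≤ η) (h : η < (a - b) / √2)
    (hσ0 : 0 ≤ σ) (hσ1 : σ ≤ 1)
    (hle : (√((1 + σ) / 2 * a ^ 2 + (1 - σ) / 2 * b ^ 2) -
      √((1 - σ) / 2 * a ^ 2 + (1 + σ) / 2 * b ^ 2)) ^ 2 ≤ 2 * η ^ 2) :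
    σ ≤ attackSin a b η := by
  have hba := lt_of_lt_gap hη h
  have e1 := Real.sq_sqrt (show 0 ≤ (1 + σ) / 2 * a ^ 2 + (1 - σ) / 2 * b ^ 2 from
    add_nonneg (mul_nonneg (by linarith) (sq_nonneg _)) (mul_nonneg (by linarith) (sq_nonneg _)))
  have e2 := Real.sq_sqrt (show 0 ≤ (1 - σ) / 2 * a ^ 2 + (1 + σ) / 2 * b ^ 2 from
    add_nonneg (mul_nonneg (by linarith) (sq_nonneg _)) (mul_nonneg (by linarith) (sq_nonneg _)))
  set N := √((1 + σ) / 2 * a ^ 2 + (1 - σ) / 2 * b ^ 2)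
  set M := √((1 - σ) / 2 * a ^ 2 + (1 + σ) / 2 * b ^ 2)
  have hc : attackC a b η ≤ N * M := by unfold attackC; nlinarith
  have hab : 0 ≤ a * b := mul_nonneg (hb.trans hba.le) hb
  have h0 : 0 ≤ attackC a b η := hab.trans (mul_lt_attackC hη h).le
  have h1 := pow_le_pow_left₀ h0 hc 2
  rw [mul_pow, e1, e2] at h1
  have h2 := attackW_mul hb hη h
  have h3 : 0 < (a ^ 2 - b ^ 2) ^ 2 := by
    have : 0 < a ^ 2 - b ^ 2 := by nlinarith
    positivity
  have h4 : attackW a b η * (a ^ 2 - b ^ 2) ^ 2 ≤ (1 - σ ^ 2) / 4 * (a ^ 2 - b ^ 2) ^ 2 := by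
    rw [h2]; nlinarith
  have h5 := le_of_mul_le_mul_right h4 h3
  exact Real.le_sqrt_of_sq_le (by linarith)

/-- The cosine `ρ` of the angle between the rows of `V`, up to its sign. -/
def attackRho (a b η : ℝ) : ℝ :=
  attackP11 a b η * attackP21 a b η * (a ^ 2 - b ^ 2) / attackC a b η

theorem attackRho_pos (hb : 0 ≤ b) (hη : 0 ≤ η) (h : η < (a - b) / √2) : 0 < attackRho a b η := by
  have hba := lt_of_lt_gap hη h
  have hab : 0 ≤ a * b := mul_nonneg (hb.trans hba.le) hb
  have h0 : 0 < attackC a b η := hab.trans_lt (mul_lt_attackC hη h)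
  have h1 : 0 < a ^ 2 - b ^ 2 := by nlinarith
  have h2 := attackP11_pos (a := a) (b := b) (η := η)
  have h3 := attackP21_pos hb hη h
  unfold attackRho
  positivity

theorem attackR_sq (hb : 0 ≤ b) (hη : 0 ≤ η) (h : η < (a - b) / √2) :
    attackR a b η ^ 2 = (a ^ 2 + b ^ 2 + 2 * attackC a b η) / 4 := by
  rw [← attackA_sq_add_sq hb hη h, ← attackA_mul_attackA' hb hη h]
  unfold attackR; ring

theorem attackV_row_zero (hb : 0 ≤ b) (hη : 0 ≤ η) (h : η < (a - b) / √2) :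
    attackV a b η 0 0 ^ 2 + attackV a b η 0 1 ^ 2 = attackR a b η ^ 2 := by
  have hA := (attackA_pos hb hη h).ne'
  simp only [attackV, Matrix.of_apply, Matrix.cons_val', Matrix.cons_val_zero, Matrix.cons_val_one,
    Matrix.cons_val_fin_one]
  field_simp
  rw [attackA_sq]

theorem attackV_row_one (hb : 0 ≤ b) (hη : 0 ≤ η) (h : η < (a - b) / √2) :
    attackV a b η 1 0 ^ 2 + attackV a b η 1 1 ^ 2 = attackR a b η ^ 2 := by
  have hA := (attackA'_pos hb hη h).ne'
  simp only [attackV, Matrix.of_apply, Matrix.cons_val', Matrix.cons_val_zero, Matrix.cons_val_one,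
    Matrix.cons_val_fin_one]
  field_simp
  rw [attackA'_sq]

theorem attackV_rows_inner (hb : 0 ≤ b) (hη : 0 ≤ η) (h : η < (a - b) / √2) :
    attackV a b η 0 0 * attackV a b η 1 0 + attackV a b η 0 1 * attackV a b η 1 1 =
      -(attackR a b η ^ 2 * attackRho a b η) := by
  have hA := (attackA_pos hb hη h).ne'
  have hA' := (attackA'_pos hb hη h).ne'
  unfold attackRho
  rw [← attackA_mul_attackA' hb hη h]
  simp only [attackV, Matrix.of_apply, Matrix.cons_val', Matrix.cons_val_zero, Matrix.cons_val_one,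
    Matrix.cons_val_fin_one]
  field_simp
  ring

/-- The sum of the squared entries of the block is `(r - A) ^ 2 + (r - A') ^ 2 = η ^ 2`. -/
theorem smallBudgetBlock_sum_sq (hb : 0 ≤ b) (hη : 0 ≤ η) (h : η < (a - b) / √2) :
    smallBudgetBlock a b η 0 0 ^ 2 + smallBudgetBlock a b η 0 1 ^ 2 +
      smallBudgetBlock a b η 1 0 ^ 2 + smallBudgetBlock a b η 1 1 ^ 2 = η ^ 2 := by
  have hA := (attackA_pos hb hη h).ne'
  have hA' := (attackA'_pos hb hη h).ne'
  have r0 := attackV_row_zero hb hη h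
  have r1 := attackV_row_one hb hη h
  have hp := attackP_sq_add_sq hb hη h
  have i0 : attackV a b η 0 0 * (attackP11 a b η * a) + attackV a b η 0 1 * (attackP21 a b η * b) =
      attackR a b η * attackA a b η := by
    simp only [attackV, Matrix.of_apply, Matrix.cons_val', Matrix.cons_val_zero,
      Matrix.cons_val_one, Matrix.cons_val_fin_one]
    field_simp
    rw [attackA_sq]
  have i1 : attackV a b η 1 0 * (-attackP21 a b η * a) + attackV a b η 1 1 * (attackP11 a b η * b) =
      attackR a b η * attackA' a b η := by
    simp only [attackV, Matrix.of_apply, Matrix.cons_val', Matrix.cons_val_zero,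
      Matrix.cons_val_one, Matrix.cons_val_fin_one]
    field_simp
    rw [attackA'_sq]
  have hC := attackA_mul_attackA' hb hη h
  have hS := attackA_sq_add_sq hb hη h
  have hR : attackR a b η = (attackA a b η + attackA' a b η) / 2 := rfl
  have hC' : attackC a b η = (a ^ 2 + b ^ 2) / 2 - η ^ 2 := rfl
  simp only [smallBudgetBlock, Matrix.sub_apply, Matrix.mul_apply, Fin.sum_univ_two,
    Matrix.of_apply, Matrix.cons_val', Matrix.cons_val_zero, Matrix.cons_val_one,
    Matrix.cons_val_fin_one]
  generalize attackV a b η 0 0 = v₁ at *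
  generalize attackV a b η 0 1 = v₃ at *
  generalize attackV a b η 1 0 = v₂ at *
  generalize attackV a b η 1 1 = v₄ at *
  rw [hR] at r0 r1 i0 i1
  linear_combination (v₁ ^ 2 + v₂ ^ 2 + v₃ ^ 2 + v₄ ^ 2) * hp + r0 + r1 - 2 * i0 - 2 * i1 -
    hS / 2 - hC - hC'

/-- The entries of `N Nᵀ`, where `N = P V` is the block of the modified data matrix, up to the
signs of its off-diagonal entries. -/
theorem smallBudgetBlock_gram (hb : 0 ≤ b) (hη : 0 ≤ η) (h : η < (a - b) / √2) :
    (a + smallBudgetBlock a b η 0 0) ^ 2 + smallBudgetBlock a b η 0 1 ^ 2 =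
      attackR a b η ^ 2 * (1 + 2 * (attackP11 a b η * attackP21 a b η) * attackRho a b η) ∧
    (a + smallBudgetBlock a b η 0 0) * smallBudgetBlock a b η 1 0 +
        smallBudgetBlock a b η 0 1 * (b + smallBudgetBlock a b η 1 1) =
      attackR a b η ^ 2 * (attackRho a b η * (attackP21 a b η ^ 2 - attackP11 a b η ^ 2)) ∧
    smallBudgetBlock a b η 1 0 ^ 2 + (b + smallBudgetBlock a b η 1 1) ^ 2 =
      attackR a b η ^ 2 * (1 - 2 * (attackP11 a b η * attackP21 a b η) * attackRho a b η) := by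
  have r0 := attackV_row_zero hb hη h
  have r1 := attackV_row_one hb hη h
  have ri := attackV_rows_inner hb hη h
  have hp := attackP_sq_add_sq hb hη h
  simp only [smallBudgetBlock, Matrix.sub_apply, Matrix.mul_apply, Fin.sum_univ_two,
    Matrix.of_apply, Matrix.cons_val', Matrix.cons_val_zero, Matrix.cons_val_one,
    Matrix.cons_val_fin_one]
  generalize attackV a b η 0 0 = v₁ at *
  generalize attackV a b η 0 1 = v₃ at *
  generalize attackV a b η 1 0 = v₂ at *
  generalize attackV a b η 1 1 = v₄ at *
  generalize attackP11 a b η = p at *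
  generalize attackP21 a b η = t at *
  generalize attackR a b η = r at *
  generalize attackRho a b η = ρ at *
  refine ⟨?_, ?_, ?_⟩
  · linear_combination p ^ 2 * r0 + t ^ 2 * r1 - 2 * p * t * ri + r ^ 2 * hp
  · linear_combination p * t * r0 - p * t * r1 + (p ^ 2 - t ^ 2) * ri
  · linear_combination t ^ 2 * r0 + p ^ 2 * r1 + 2 * p * t * ri + r ^ 2 * hp

end ClosedForms

/-! ### Perturbations of a `2 × 2` block of the singular values -/

section Block

variable {d n k : ℕ}

theorem norm_sq_embedBlock (hk : 1 ≤ k) (hkd : k < d) (hkn : k < n)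
    (B : Matrix (Fin 2) (Fin 2) ℝ) :
    ‖embedBlock d n k B‖ ^ 2 = B 0 0 ^ 2 + B 0 1 ^ 2 + B 1 0 ^ 2 + B 1 1 ^ 2 := by
  rw [norm_sq_eq_sum_sq]
  have hrow : ∀ i : Fin d, ∑ j, embedBlock d n k B i j ^ 2 =
      (if i = ⟨k - 1, by omega⟩ then B 0 0 ^ 2 + B 0 1 ^ 2 else 0) +
      (if i = ⟨k, hkd⟩ then B 1 0 ^ 2 + B 1 1 ^ 2 else 0) := by
    intro i
    have hentry : ∀ j : Fin n, embedBlock d n k B i j ^ 2 =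
        (if j = ⟨k - 1, by omega⟩ then (if i = ⟨k - 1, by omega⟩ then B 0 0 ^ 2 else 0) +
          (if i = ⟨k, hkd⟩ then B 1 0 ^ 2 else 0) else 0) +
        (if j = ⟨k, hkn⟩ then (if i = ⟨k - 1, by omega⟩ then B 0 1 ^ 2 else 0) +
          (if i = ⟨k, hkd⟩ then B 1 1 ^ 2 else 0) else 0) := by
      intro j
      simp only [embedBlock, Matrix.of_apply, Fin.ext_iff]
      split_ifs <;> first | omega | grind
    simp only [hentry, Finset.sum_add_distrib, Finset.sum_ite_eq', Finset.mem_univ, if_true]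
    split_ifs <;> ring
  simp only [hrow, Finset.sum_add_distrib, Finset.sum_ite_eq', Finset.mem_univ, if_true]
  ring

/-- The rows of `Σ + B`. -/
theorem rectDiag_add_embedBlock_rows (hk : 1 ≤ k) (hkd : k < d) (hkn : k < n) (σ : ℕ → ℝ)
    (B : Matrix (Fin 2) (Fin 2) ℝ) :
    ((rectDiag d n σ + embedBlock d n k B) ⟨k - 1, by omega⟩ =
      Pi.single ⟨k - 1, by omega⟩ (σ (k - 1) + B 0 0) + Pi.single ⟨k, hkn⟩ (B 0 1)) ∧
    ((rectDiag d n σ + embedBlock d n k B) ⟨k, hkd⟩ =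
      Pi.single ⟨k - 1, by omega⟩ (B 1 0) + Pi.single ⟨k, hkn⟩ (σ k + B 1 1)) ∧
    ∀ i : Fin d, (i : ℕ) ≠ k - 1 → (i : ℕ) ≠ k → (rectDiag d n σ + embedBlock d n k B) i =
      if h : (i : ℕ) < n then Pi.single ⟨i, h⟩ (σ i) else 0 := by
  refine ⟨?_, ?_, fun i h1 h2 => ?_⟩
  · ext j
    simp only [Matrix.add_apply, rectDiag, embedBlock, Matrix.of_apply, Pi.add_apply,
      Pi.single_apply, Fin.ext_iff]
    split_ifs <;> first | omega | grind
  · ext j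
    simp only [Matrix.add_apply, rectDiag, embedBlock, Matrix.of_apply, Pi.add_apply,
      Pi.single_apply, Fin.ext_iff]
    split_ifs <;> first | omega | grind
  · ext j
    by_cases h : (i : ℕ) < n
    · simp only [Matrix.add_apply, rectDiag, embedBlock, Matrix.of_apply, dif_pos h,
        Pi.single_apply, Fin.ext_iff]
      split_ifs <;> first | omega | grind
    · simp only [Matrix.add_apply, rectDiag, embedBlock, Matrix.of_apply, dif_neg h,
        Pi.zero_apply]
      have := j.2
      split_ifs <;> first | omega | grind

theorem mul_transpose_mulVec_single {S : Matrix (Fin d) (Fin n) ℝ} (i : Fin d) :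
    (S * Sᵀ) *ᵥ Pi.single i 1 = fun l => S l ⬝ᵥ S i := by
  ext l
  rw [Matrix.mulVec_single_one]
  rfl

/-- The action of `Y Yᵀ` on the left singular vectors of `X`, for `Y = X + U B Vᵀ`. -/
theorem perturbed_apply (hk : 1 ≤ k) (hkd : k < d) (hkn : k < n) {X : Matrix (Fin d) (Fin n) ℝ}
    {U : Matrix (Fin d) (Fin d) ℝ} {V : Matrix (Fin n) (Fin n) ℝ} (h : IsFullSVD X U V)
    {w : OrthonormalBasis (Fin d) ℝ (EuclideanSpace ℝ (Fin d))}
    (hw : ∀ j, w j = WithLp.toLp 2 (fun i => U i j)) (B : Matrix (Fin 2) (Fin 2) ℝ)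
    {Y : Matrix (Fin d) (Fin n) ℝ} (hY : Y = X + U * embedBlock d n k B * Vᵀ) :
    Matrix.toEuclideanLin (Y * Yᵀ) (w ⟨k - 1, by omega⟩) =
        ((singVal X (k - 1) + B 0 0) ^ 2 + B 0 1 ^ 2) • w ⟨k - 1, by omega⟩ +
        ((singVal X (k - 1) + B 0 0) * B 1 0 + B 0 1 * (singVal X k + B 1 1)) • w ⟨k, hkd⟩ ∧
    Matrix.toEuclideanLin (Y * Yᵀ) (w ⟨k, hkd⟩) =
        ((singVal X (k - 1) + B 0 0) * B 1 0 + B 0 1 * (singVal X k + B 1 1)) •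
          w ⟨k - 1, by omega⟩ +
        (B 1 0 ^ 2 + (singVal X k + B 1 1) ^ 2) • w ⟨k, hkd⟩ ∧
    ∀ i : Fin d, (i : ℕ) ≠ k - 1 → (i : ℕ) ≠ k →
      Matrix.toEuclideanLin (Y * Yᵀ) (w i) = (singVal X i ^ 2) • w i := by
  obtain ⟨hU, hV, hX⟩ := h
  set σ := singVal X with hσ
  clear_value σ
  set S := rectDiag d n σ + embedBlock d n k B with hS
  have hYS : Y = U * S * Vᵀ := by
    rw [hY, hX, hS, Matrix.mul_add, Matrix.add_mul]
  have hcol : ∀ i, w i = WithLp.toLp 2 (U *ᵥ Pi.single i 1) := by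
    intro i
    rw [hw, Matrix.mulVec_single_one]; rfl
  have happ : ∀ i, Matrix.toEuclideanLin (Y * Yᵀ) (w i) =
      WithLp.toLp 2 (U *ᵥ fun l => S l ⬝ᵥ S i) := by
    intro i
    rw [hcol, hYS, toEuclideanLin_conj_apply hU hV, mul_transpose_mulVec_single]
  have hlin : ∀ (x y : ℝ) (i j : Fin d), x • w i + y • w j =
      WithLp.toLp 2 (U *ᵥ (x • Pi.single i 1 + y • Pi.single j 1)) := by
    intro x y i j
    rw [hcol, hcol, Matrix.mulVec_add, Matrix.mulVec_smul, Matrix.mulVec_smul]; rfl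
  obtain ⟨r0, r1, r2⟩ := rectDiag_add_embedBlock_rows hk hkd hkn σ B
  rw [← hS] at r0 r1 r2
  have hcases : ∀ l : Fin d, l = ⟨k - 1, by omega⟩ ∨ l = ⟨k, hkd⟩ ∨
      ((l : ℕ) ≠ k - 1 ∧ (l : ℕ) ≠ k) := by
    intro l; simp only [Fin.ext_iff]; omega
  have hne : k - 1 ≠ k := by omega
  refine ⟨?_, ?_, fun i hi1 hi2 => ?_⟩
  · rw [happ, hlin]
    congr 2
    ext l
    rcases hcases l with rfl | rfl | ⟨h1, h2⟩
    · rw [r0]; simp [Fin.ext_iff, hne, hne.symm]; ring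
    · rw [r0, r1]; simp [Fin.ext_iff, hne, hne.symm]; ring
    · rw [r0, r2 l h1 h2]
      split_ifs <;> simp [Fin.ext_iff, h1, h2, h1.symm, h2.symm]
  · rw [happ, hlin]
    congr 2
    ext l
    rcases hcases l with rfl | rfl | ⟨h1, h2⟩
    · rw [r0, r1]; simp [Fin.ext_iff, hne, hne.symm]
    · rw [r1]; simp [Fin.ext_iff, hne, hne.symm]; ring
    · rw [r1, r2 l h1 h2]
      split_ifs <;> simp [Fin.ext_iff, h1, h2, h1.symm, h2.symm]
  · have := hlin (σ i ^ 2) 0 i i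
    rw [zero_smul, add_zero, zero_smul, add_zero] at this
    rw [happ, this]
    congr 2
    ext l
    have hσn : n ≤ (i : ℕ) → σ i = 0 := fun hn => by rw [hσ]; exact singVal_of_le X hn
    rcases hcases l with rfl | rfl | ⟨h1, h2⟩
    · rw [r0, r2 i hi1 hi2]
      split_ifs <;> simp [Fin.ext_iff, hi1, hi2, hi1.symm]
    · rw [r1, r2 i hi1 hi2]
      split_ifs <;> simp [Fin.ext_iff, hi1, hi2, hi2.symm]
    · rw [r2 l h1 h2, r2 i hi1 hi2]
      by_cases hli : l = i
      · subst hli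
        by_cases hn : (l : ℕ) < n
        · simp [hn, pow_two]
        · simp [hn, hσn (not_lt.1 hn)]
      · have : (l : ℕ) ≠ i := fun h' => hli (Fin.ext h')
        split_ifs <;> simp [Fin.ext_iff, this, this.symm]

/-- The left singular vectors are eigenvectors of `X Xᵀ`. -/
theorem IsFullSVD.apply_column (hk : 1 ≤ k) (hkd : k < d) (hkn : k < n)
    {X : Matrix (Fin d) (Fin n) ℝ}
    {U : Matrix (Fin d) (Fin d) ℝ} {V : Matrix (Fin n) (Fin n) ℝ} (h : IsFullSVD X U V)
    {w : OrthonormalBasis (Fin d) ℝ (EuclideanSpace ℝ (Fin d))}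
    (hw : ∀ j, w j = WithLp.toLp 2 (fun i => U i j)) (i : Fin d) :
    Matrix.toEuclideanLin (X * Xᵀ) (w i) = (singVal X i ^ 2) • w i := by
  have h0 : X = X + U * embedBlock d n k 0 * Vᵀ := by
    have : embedBlock d n k 0 = 0 := by ext; simp [embedBlock]
    rw [this, Matrix.mul_zero, Matrix.zero_mul, add_zero]
  obtain ⟨e0, e1, e2⟩ := perturbed_apply hk hkd hkn h hw 0 h0
  by_cases h1 : (i : ℕ) = k - 1
  · have hi : i = ⟨k - 1, by omega⟩ := Fin.ext h1
    rw [hi]; simpa using e0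
  by_cases h2 : (i : ℕ) = k
  · have hi : i = ⟨k, hkd⟩ := Fin.ext h2
    rw [hi]; simpa using e1
  exact e2 i h1 h2

theorem sq_singVal_antitone (X : Matrix (Fin d) (Fin n) ℝ) :
    Antitone fun i : Fin d => singVal X i ^ 2 := fun _ _ hij =>
  pow_le_pow_left₀ (singVal_nonneg X _) (singVal_antitone X hij) 2

end Block

/-! ### The attack problem -/

section Attack

variable {d n k : ℕ} {X : Matrix (Fin d) (Fin n) ℝ} {U : Matrix (Fin d) (Fin d) ℝ}
  {V : Matrix (Fin n) (Fin n) ℝ} {η : ℝ}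

theorem isPCASubspace_leadingColumnSpan (hk : 1 ≤ k) (hkd : k < d) (hkn : k < n)
    (h : IsFullSVD X U V) : IsPCASubspace k X (leadingColumnSpan k U) := by
  obtain ⟨w, hw⟩ := exists_orthonormalBasis_columns h.left_orthogonal
  exact ⟨w, _, sq_singVal_antitone X, h.apply_column hk hkd hkn hw, leadingColumnSpan_eq hw k⟩

theorem finrank_leadingColumnSpan (hkd : k < d) (h : IsFullSVD X U V) :
    Module.finrank ℝ (leadingColumnSpan k U) = k := by
  obtain ⟨w, hw⟩ := exists_orthonormalBasis_columns h.left_orthogonal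
  rw [leadingColumnSpan_eq hw, finrank_span_leading w hkd.le]

theorem IsPCASubspace.exists_isFullSVD {P : Submodule ℝ (EuclideanSpace ℝ (Fin d))}
    (hP : IsPCASubspace k X P) : ∃ U V, IsFullSVD X U V ∧ P = leadingColumnSpan k U := by
  obtain ⟨w, μ, hμ, hw, rfl⟩ := hP
  obtain ⟨V, hV⟩ := _root_.exists_isFullSVD X w hμ hw
  exact ⟨_, V, hV, (leadingColumnSpan_eq (fun j => rfl) k).symm⟩

/-- Below the critical budget no perturbation exceeds the angle `θ*`. -/
theorem le_attackTheta (hk : 1 ≤ k) (hkd : k < d) (hkn : k < n) (h : IsFullSVD X U V)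
    (hη : 0 ≤ η) (hlt : η < (singVal X (k - 1) - singVal X k) / √2)
    {D : Matrix (Fin d) (Fin n) ℝ} (hD : ‖D‖ ≤ η) {Q : Submodule ℝ (EuclideanSpace ℝ (Fin d))}
    (hQ : IsPCASubspace k (X + D) Q) {θ : ℝ} (hθ : IsAsimovDistance k (leadingColumnSpan k U) Q θ) :
    θ ≤ attackTheta (singVal X (k - 1)) (singVal X k) η := by
  have hb := singVal_nonneg X k
  have hba := lt_of_lt_gap hη hlt
  have hD2 : 2 * ‖D‖ ^ 2 ≤ 2 * η ^ 2 := by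
    have := pow_le_pow_left₀ (norm_nonneg D) hD 2
    linarith
  have hθ0 := attackTheta_nonneg hb hη hlt
  have hθπ := hθ.le_pi_div_two
  obtain ⟨p, hp, q, hq, hp1, hq1, hc0, rfl, hpq, hqp⟩ :=
    hθ.exists_pair hk (finrank_leadingColumnSpan hkd h) (hQ.finrank_eq hkd.le)
  set c := inner ℝ p q with hc
  have hc1 : c ≤ 1 := by
    have := real_inner_le_norm p q
    rwa [hp1, hq1, one_mul] at this
  rcases hc1.eq_or_lt with hceq | hclt
  · rwa [hceq, Real.arccos_one]
  set s := √(1 - c ^ 2) with hs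
  have hs0 : 0 < s := Real.sqrt_pos.2 (by nlinarith)
  have hcs : c ^ 2 + s ^ 2 = 1 := by
    rw [hs, Real.sq_sqrt (by nlinarith)]; ring
  obtain ⟨p', hp', q', hq', hp'1, hq'1, eq, eq', ep, ep'⟩ :=
    exists_principal_plane hp1 hq1 hc.symm hs0 hcs hpq hqp
  have hpp' : inner ℝ p p' = 0 := hp' p hp
  have hqq' : inner ℝ q q' = 0 := hq' q hq
  obtain ⟨w, hw⟩ := exists_orthonormalBasis_columns h.left_orthogonal
  rw [leadingColumnSpan_eq hw] at hp hp'
  obtain ⟨hXa, hXb, hX0⟩ := pca_split w (sq_singVal_antitone X) (h.apply_column hk hkd hkn hw)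
    hk hkd hp hp'
  obtain ⟨w₂, μ, hμ, hw₂, rfl⟩ := hQ
  obtain ⟨hYa, hYb, hY0⟩ := pca_split w₂ hμ hw₂ hk hkd hq hq'
  rw [hp1, one_pow, mul_one] at hXa
  rw [hp'1, one_pow, mul_one] at hXb
  rw [hq1, one_pow, mul_one] at hYa
  rw [hq'1, one_pow, mul_one] at hYb
  have hYY := hYb.trans ((hμ (Fin.le_def.2 (Nat.sub_le k 1))).trans hYa)
  have hsc : s < c := by
    by_contra! hcs'
    have h1 := energy_bound_of_cos_le_sin hba.le hp1 hp'1 hpp' ep ep'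
      ((pow_le_pow_iff_left₀ (hb.trans hba.le) (norm_nonneg _) two_ne_zero).1 hXa)
      ((pow_le_pow_iff_left₀ (norm_nonneg _) hb two_ne_zero).1 hXb) hYY hY0 hc0 hcs'
    have h2 := two_mul_sq_lt hη hlt
    linarith
  have h1 := energy_bound_of_diagonals hb hba.le hq1 hq'1 hqq' eq eq' hXa hXb hX0 hY0 hc0 hs0.le hcs
  have h2 := le_attackSin hb hη hlt (mul_nonneg zero_le_two (mul_nonneg hc0 hs0.le))
    (by nlinarith [sq_nonneg (c - s)]) (h1.trans hD2)
  rw [← sin_two_mul_attackTheta hb hη hlt] at h2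
  have hcos : Real.cos (Real.arccos c) = c := Real.cos_arccos (by linarith) hc1
  have hsin : Real.sin (Real.arccos c) = s := Real.sin_arccos c
  have hsin2 : Real.sin (2 * Real.arccos c) = 2 * (c * s) := by
    rw [Real.sin_two_mul, hcos, hsin]; ring
  -- both angles lie in `[0, π / 4]`, where `sin (2 θ)` is increasing
  have h4 : 2 * Real.arccos c ≤ Real.pi / 2 := by
    by_contra! hgt
    have h5 := Real.cos_nonpos_of_pi_div_two_le_of_le hgt.le (by linarith [Real.pi_pos])
    rw [Real.cos_two_mul, hcos] at h5
    nlinarith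
  by_contra! hgt
  have h6 := Real.sin_lt_sin_of_lt_of_le_pi_div_two (by linarith [Real.pi_pos]) h4
    (mul_lt_mul_of_pos_left hgt zero_lt_two)
  linarith

theorem largeBudget_norm_le (hk : 1 ≤ k) (hkd : k < d) (hkn : k < n) (h : IsFullSVD X U V)
    (hη : 0 ≤ η) : ‖U * embedBlock d n k (largeBudgetBlock η) * Vᵀ‖ ≤ η := by
  rw [norm_orthogonal_mul_mul h.left_orthogonal h.right_orthogonal]
  refine le_of_eq ((pow_left_inj₀ (norm_nonneg _) hη two_ne_zero).1 ?_)
  rw [norm_sq_embedBlock hk hkd hkn]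
  simp [largeBudgetBlock, div_pow]

/-- The action of `Y Yᵀ` on the left singular vectors of `X` for the attack with a large budget. -/
theorem largeBudget_apply (hk : 1 ≤ k) (hkd : k < d) (hkn : k < n) (h : IsFullSVD X U V)
    {w : OrthonormalBasis (Fin d) ℝ (EuclideanSpace ℝ (Fin d))}
    (hw : ∀ j, w j = WithLp.toLp 2 (fun i => U i j))
    {Y : Matrix (Fin d) (Fin n) ℝ} (hY : Y = X + U * embedBlock d n k (largeBudgetBlock η) * Vᵀ) :
    Matrix.toEuclideanLin (Y * Yᵀ) (w ⟨k - 1, by omega⟩) =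
      ((singVal X (k - 1) - η / √2) ^ 2) • w ⟨k - 1, by omega⟩ ∧
    Matrix.toEuclideanLin (Y * Yᵀ) (w ⟨k, hkd⟩) =
      ((singVal X k + η / √2) ^ 2) • w ⟨k, hkd⟩ ∧
    ∀ i : Fin d, (i : ℕ) ≠ k - 1 → (i : ℕ) ≠ k →
      Matrix.toEuclideanLin (Y * Yᵀ) (w i) = (singVal X i ^ 2) • w i := by
  obtain ⟨e0, e1, e2⟩ := perturbed_apply hk hkd hkn h hw _ hY
  refine ⟨?_, ?_, e2⟩
  · rw [e0]; simp [largeBudgetBlock, neg_div, sub_eq_add_neg]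
  · rw [e1]; simp [largeBudgetBlock]

theorem column_mem_orthogonal (hkd : k < d)
    {w : OrthonormalBasis (Fin d) ℝ (EuclideanSpace ℝ (Fin d))}
    (hw : ∀ j, w j = WithLp.toLp 2 (fun i => U i j)) :
    w ⟨k, hkd⟩ ∈ (leadingColumnSpan k U)ᗮ := by
  rw [leadingColumnSpan_eq hw]
  intro x hx
  rw [real_inner_comm]
  exact inner_eq_zero_of_mem_span_image w hx (by simp)

/-- Above the critical budget the `(k + 1)`-st left singular vector of `X` belongs to every PCA
subspace of the modified matrix. -/
theorem largeBudget_forall (hk : 1 ≤ k) (hkd : k < d) (hkn : k < n) (h : IsFullSVD X U V)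
    (ha : 0 < singVal X (k - 1)) (hlt : (singVal X (k - 1) - singVal X k) / √2 < η)
    {Q : Submodule ℝ (EuclideanSpace ℝ (Fin d))}
    (hQ : IsPCASubspace k (X + U * embedBlock d n k (largeBudgetBlock η) * Vᵀ) Q) :
    IsAsimovDistance k (leadingColumnSpan k U) Q (Real.pi / 2) := by
  obtain ⟨w, hw⟩ := exists_orthonormalBasis_columns h.left_orthogonal
  set Y := X + U * embedBlock d n k (largeBudgetBlock η) * Vᵀ with hY
  obtain ⟨e0, e1, e2⟩ := largeBudget_apply hk hkd hkn h hw hY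
  have hQfin := hQ.finrank_eq hkd.le
  obtain ⟨w₂, μ, hμ, hw₂, rfl⟩ := hQ
  have hb := singVal_nonneg X k
  have hba : singVal X k ≤ singVal X (k - 1) := singVal_antitone X (Nat.sub_le k 1)
  set a := singVal X (k - 1) with ha'
  set b := singVal X k with hb'
  have ht : a - b < 2 * (η / √2) := by
    rw [div_lt_iff₀ (by positivity)] at hlt
    have h2 : η / √2 = η * √2 / 2 := by
      rw [div_eq_div_iff (by positivity) two_ne_zero, mul_assoc, Real.mul_self_sqrt zero_le_two]
    linarith
  set t := η / √2
  refine isAsimovDistance_pi_div_two hk (finrank_leadingColumnSpan hkd h) hQfin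
    (y := w ⟨k, hkd⟩) ?_ (w.orthonormal.ne_zero _) (column_mem_orthogonal hkd hw)
  -- the smaller eigenvalues belong to `w (k - 1)` and to the vectors after `w k`
  set i₀ : Fin d := ⟨k - 1, by omega⟩ with hi₀
  set i₁ : Fin d := ⟨k, hkd⟩ with hi₁
  have h01 : i₀ ≠ i₁ := by simp only [hi₀, hi₁, ne_eq, Fin.mk.injEq]; omega
  have hswap : ∀ j : Fin d, k ≤ (j : ℕ) → j ≠ i₁ → Equiv.swap i₀ i₁ j = j := fun j hj hj1 =>
    Equiv.swap_apply_of_ne_of_ne (fun h' => by rw [h', hi₀] at hj; simp at hj; omega) hj1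
  refine mem_span_leading_of_eigenvalue_gt (isSymmetric_mul_transpose Y) w₂ hμ hw₂ e1
    (f := fun j => w (Equiv.swap i₀ i₁ j))
    (β := fun j => if (j : Fin d) = i₁ then (a - t) ^ 2 else singVal X (j : Fin d) ^ 2)
    (w.orthonormal.comp _ ((Equiv.swap i₀ i₁).injective.comp Subtype.val_injective)) ?_ ?_
  · rintro ⟨j, hj⟩
    by_cases hj1 : j = i₁
    · simp only [hj1, Equiv.swap_apply_right, if_true]
      exact e0
    · simp only [hswap j hj hj1, hj1, if_false]
      refine e2 j (by omega) (fun h' => hj1 (Fin.ext h'))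
  · rintro ⟨j, hj⟩
    by_cases hj1 : j = i₁
    · simp only [hj1, if_true]
      have : 0 < (b + t - (a - t)) * (b + t + (a - t)) := mul_pos (by linarith) (by linarith)
      nlinarith
    · simp only [hj1, if_false]
      have h1 : singVal X j ≤ b := singVal_antitone X hj
      exact pow_lt_pow_left₀ (by linarith) (singVal_nonneg X _) two_ne_zero

/-- At the critical budget the `k`-th and the `(k + 1)`-st eigenvalue coincide, so the left
singular vectors of `X` with the `k`-th and the `(k + 1)`-st interchanged are still a sorted
eigenbasis. -/
theorem largeBudget_exists_of_eq (hk : 1 ≤ k) (hkd : k < d) (hkn : k < n) (h : IsFullSVD X U V)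
    (heq : (singVal X (k - 1) - singVal X k) / √2 = η) :
    ∃ Q, IsPCASubspace k (X + U * embedBlock d n k (largeBudgetBlock η) * Vᵀ) Q ∧
      IsAsimovDistance k (leadingColumnSpan k U) Q (Real.pi / 2) := by
  obtain ⟨w, hw⟩ := exists_orthonormalBasis_columns h.left_orthogonal
  set Y := X + U * embedBlock d n k (largeBudgetBlock η) * Vᵀ with hY
  obtain ⟨e0, e1, e2⟩ := largeBudget_apply hk hkd hkn h hw hY
  have hb := singVal_nonneg X k
  have hba : singVal X k ≤ singVal X (k - 1) := singVal_antitone X (Nat.sub_le k 1)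
  have ht : η / √2 = (singVal X (k - 1) - singVal X k) / 2 := by
    rw [← heq, div_div, Real.mul_self_sqrt zero_le_two]
  set a := singVal X (k - 1) with ha'
  set b := singVal X k with hb'
  have ea : a - η / √2 = (a + b) / 2 := by rw [ht]; ring
  have eb : b + η / √2 = (a + b) / 2 := by rw [ht]; ring
  rw [ea] at e0
  rw [eb] at e1
  set i₀ : Fin d := ⟨k - 1, by omega⟩ with hi₀
  set i₁ : Fin d := ⟨k, hkd⟩ with hi₁
  have hPCA : IsPCASubspace k Y (Submodule.span ℝ
      ((w.reindex (Equiv.swap i₀ i₁)) '' {i | (i : ℕ) < k})) := by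
    refine ⟨_, fun i => (if (i : ℕ) = k - 1 ∨ (i : ℕ) = k then (a + b) / 2 else singVal X i) ^ 2,
      fun i j hij => ?_, fun i => ?_, rfl⟩
    · have hij' : (i : ℕ) ≤ j := hij
      have hanti := singVal_antitone X
      refine pow_le_pow_left₀ ?_ ?_ 2
      · split_ifs
        · linarith
        · exact singVal_nonneg X _
      · split_ifs with h1 h2 h2
        · exact le_rfl
        · have : a ≤ singVal X i := hanti (by omega)
          linarith
        · have : singVal X j ≤ b := hanti (by omega)
          linarith
        · exact hanti hij'
    · rw [OrthonormalBasis.reindex_apply, Equiv.symm_swap]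
      by_cases h0 : i = i₀
      · subst h0
        simp only [Equiv.swap_apply_left, hi₀, true_or, if_true]; exact e1
      by_cases h1 : i = i₁
      · subst h1
        simp only [Equiv.swap_apply_right, hi₁, or_true, if_true]; exact e0
      have h0' : (i : ℕ) ≠ k - 1 := fun h' => h0 (Fin.ext h')
      have h1' : (i : ℕ) ≠ k := fun h' => h1 (Fin.ext h')
      simp only [Equiv.swap_apply_of_ne_of_ne h0 h1, h0', h1', or_self, if_false]
      exact e2 i h0' h1'
  refine ⟨_, hPCA, isAsimovDistance_pi_div_two hk (finrank_leadingColumnSpan hkd h)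
    (hPCA.finrank_eq hkd.le) (y := w i₁) (Submodule.subset_span ⟨i₀, ?_, ?_⟩)
    (w.orthonormal.ne_zero _) (column_mem_orthogonal hkd hw)⟩
  · simp only [hi₀, Set.mem_ofPred_eq]; omega
  · rw [OrthonormalBasis.reindex_apply, Equiv.symm_swap, Equiv.swap_apply_left]

theorem largeBudget_exists (hk : 1 ≤ k) (hkd : k < d) (hkn : k < n) (h : IsFullSVD X U V)
    (ha : 0 < singVal X (k - 1)) (hle : (singVal X (k - 1) - singVal X k) / √2 ≤ η) :
    ∃ Q, IsPCASubspace k (X + U * embedBlock d n k (largeBudgetBlock η) * Vᵀ) Q ∧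
      IsAsimovDistance k (leadingColumnSpan k U) Q (Real.pi / 2) := by
  rcases hle.eq_or_lt with heq | hlt
  · exact largeBudget_exists_of_eq hk hkd hkn h heq
  · obtain ⟨Q, hQ⟩ := exists_isPCASubspace k
      (X + U * embedBlock d n k (largeBudgetBlock η) * Vᵀ)
    exact ⟨Q, hQ, largeBudget_forall hk hkd hkn h ha hlt hQ⟩

theorem orthonormal_update {E ι : Type*} [NormedAddCommGroup E] [InnerProductSpace ℝ E]
    [DecidableEq ι] {v : ι → E} (hv : Orthonormal ℝ v) (i : ι) {x : E} (hx : ‖x‖ = 1)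
    (h : ∀ j ≠ i, inner ℝ (v j) x = 0) : Orthonormal ℝ (Function.update v i x) := by
  refine ⟨fun j => ?_, fun j l hjl => ?_⟩
  · by_cases hj : j = i
    · subst hj; rwa [Function.update_self]
    · rw [Function.update_of_ne hj]; exact hv.1 j
  · by_cases hj : j = i
    · subst hj
      rw [Function.update_self, Function.update_of_ne hjl.symm]
      exact (real_inner_comm _ _).trans (h l hjl.symm)
    · by_cases hl : l = i
      · subst hl
        rw [Function.update_self, Function.update_of_ne hj]
        exact h j hj
      · show inner ℝ (Function.update v i x j) (Function.update v i x l) = 0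
        rw [Function.update_of_ne hj, Function.update_of_ne hl]
        exact hv.2 hjl

theorem smallBudget_norm_le (hk : 1 ≤ k) (hkd : k < d) (hkn : k < n) (h : IsFullSVD X U V)
    (hη : 0 ≤ η) (hlt : η < (singVal X (k - 1) - singVal X k) / √2) {ε : ℝ} (hε : ε = 1 ∨ ε = -1) :
    ‖U * embedBlock d n k (scaleOffDiag ε
      (smallBudgetBlock (singVal X (k - 1)) (singVal X k) η)) * Vᵀ‖ ≤ η := by
  rw [norm_orthogonal_mul_mul h.left_orthogonal h.right_orthogonal]
  refine le_of_eq ((pow_left_inj₀ (norm_nonneg _) hη two_ne_zero).1 ?_)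
  have hε2 : ε ^ 2 = 1 := by rcases hε with rfl | rfl <;> norm_num
  rw [norm_sq_embedBlock hk hkd hkn, ← smallBudgetBlock_sum_sq (singVal_nonneg X k) hη hlt]
  simp [scaleOffDiag, mul_pow, hε2]

/-- The two rotated left singular vectors are eigenvectors of `Y Yᵀ` for the attack with a small
budget. -/
theorem smallBudget_apply (hk : 1 ≤ k) (hkd : k < d) (hkn : k < n) (h : IsFullSVD X U V)
    (hη : 0 ≤ η) (hlt : η < (singVal X (k - 1) - singVal X k) / √2) {ε : ℝ} (hε : ε ^ 2 = 1)
    {w : OrthonormalBasis (Fin d) ℝ (EuclideanSpace ℝ (Fin d))}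
    (hw : ∀ j, w j = WithLp.toLp 2 (fun i => U i j)) {a b : ℝ} (ha : a = singVal X (k - 1))
    (hb : b = singVal X k) {Y : Matrix (Fin d) (Fin n) ℝ}
    (hY : Y = X + U * embedBlock d n k (scaleOffDiag ε (smallBudgetBlock a b η)) * Vᵀ)
    {C S : ℝ} (hC : C = (attackP11 a b η + attackP21 a b η) / √2)
    (hS : S = (attackP21 a b η - attackP11 a b η) / √2) :
    Matrix.toEuclideanLin (Y * Yᵀ) (C • w ⟨k - 1, by omega⟩ + (ε * S) • w ⟨k, hkd⟩) =
      (attackR a b η ^ 2 * (1 + attackRho a b η)) •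
        (C • w ⟨k - 1, by omega⟩ + (ε * S) • w ⟨k, hkd⟩) ∧
    Matrix.toEuclideanLin (Y * Yᵀ) ((-(ε * S)) • w ⟨k - 1, by omega⟩ + C • w ⟨k, hkd⟩) =
      (attackR a b η ^ 2 * (1 - attackRho a b η)) •
        ((-(ε * S)) • w ⟨k - 1, by omega⟩ + C • w ⟨k, hkd⟩) := by
  obtain ⟨e0, e1, -⟩ := perturbed_apply hk hkd hkn h hw _ hY
  rw [← ha, ← hb] at e0 e1 hlt
  have hb0 : 0 ≤ b := hb ▸ singVal_nonneg X k
  obtain ⟨g0, g1, g2⟩ := smallBudgetBlock_gram hb0 hη hlt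
  have hp := attackP_sq_add_sq hb0 hη hlt
  simp only [scaleOffDiag, Matrix.of_apply, Matrix.cons_val', Matrix.cons_val_zero,
    Matrix.cons_val_one, Matrix.cons_val_fin_one] at e0 e1
  have h00 : (a + smallBudgetBlock a b η 0 0) ^ 2 + (ε * smallBudgetBlock a b η 0 1) ^ 2 =
      attackR a b η ^ 2 * (1 + 2 * (attackP11 a b η * attackP21 a b η) * attackRho a b η) := by
    rw [mul_pow, hε, one_mul, g0]
  have h01 : (a + smallBudgetBlock a b η 0 0) * (ε * smallBudgetBlock a b η 1 0) +
      ε * smallBudgetBlock a b η 0 1 * (b + smallBudgetBlock a b η 1 1) =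
      ε * (attackR a b η ^ 2 *
        (attackRho a b η * (attackP21 a b η ^ 2 - attackP11 a b η ^ 2))) := by
    rw [← g1]; ring
  have h11 : (ε * smallBudgetBlock a b η 1 0) ^ 2 + (b + smallBudgetBlock a b η 1 1) ^ 2 =
      attackR a b η ^ 2 * (1 - 2 * (attackP11 a b η * attackP21 a b η) * attackRho a b η) := by
    rw [mul_pow, hε, one_mul, g2]
  rw [h00, h01] at e0
  rw [h01, h11] at e1
  generalize attackP11 a b η = p at *
  generalize attackP21 a b η = t at *
  generalize attackR a b η = r at *
  generalize attackRho a b η = ρ at *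
  have hdiv : ∀ z : ℝ, z / √2 = z * (√2)⁻¹ := fun z => div_eq_mul_inv _ _
  rw [hdiv] at hC hS
  generalize (√2)⁻¹ = g at *
  have k1 : C * (r ^ 2 * (1 + 2 * (p * t) * ρ)) + S * (r ^ 2 * (ρ * (t ^ 2 - p ^ 2))) =
      r ^ 2 * (1 + ρ) * C := by
    rw [hC, hS]; linear_combination (r ^ 2 * ρ * g * (p + t)) * hp
  have k2 : C * (r ^ 2 * (ρ * (t ^ 2 - p ^ 2))) + S * (r ^ 2 * (1 - 2 * (p * t) * ρ)) =
      r ^ 2 * (1 + ρ) * S := by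
    rw [hC, hS]; linear_combination (r ^ 2 * ρ * g * (t - p)) * hp
  have k3 : -S * (r ^ 2 * (1 + 2 * (p * t) * ρ)) + C * (r ^ 2 * (ρ * (t ^ 2 - p ^ 2))) =
      r ^ 2 * (1 - ρ) * -S := by
    rw [hC, hS]; linear_combination (r ^ 2 * ρ * g * (t - p)) * hp
  have k4 : -S * (r ^ 2 * (ρ * (t ^ 2 - p ^ 2))) + C * (r ^ 2 * (1 - 2 * (p * t) * ρ)) =
      r ^ 2 * (1 - ρ) * C := by
    rw [hC, hS]; linear_combination (-(r ^ 2 * ρ * g * (p + t))) * hp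
  constructor
  · rw [map_add, map_smul, map_smul, e0, e1]
    match_scalars
    · linear_combination k1 + S * (r ^ 2 * (ρ * (t ^ 2 - p ^ 2))) * hε
    · linear_combination ε * k2
  · rw [map_add, map_smul, map_smul, e0, e1]
    match_scalars
    · linear_combination ε * k3
    · linear_combination k4 - S * (r ^ 2 * (ρ * (t ^ 2 - p ^ 2))) * hε

/-- The smaller eigenvalue `r² (1 - ρ)` of the perturbed block lies below `σₖ²`, the larger one
`r² (1 + ρ)` lies above `σₖ₊₁²`, so the attack does not change the order of the other
eigenvalues. -/
theorem smallBudget_eigenvalues {a b : ℝ} (hb : 0 ≤ b) (hη : 0 ≤ η) (hlt : η < (a - b) / √2) :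
    attackR a b η ^ 2 * (1 - attackRho a b η) < attackR a b η ^ 2 * (1 + attackRho a b η) ∧
      attackR a b η ^ 2 * (1 - attackRho a b η) < a ^ 2 ∧
      b ^ 2 < attackR a b η ^ 2 * (1 + attackRho a b η) := by
  have hρ := attackRho_pos hb hη hlt
  have hR := attackR_sq hb hη hlt
  have hba := lt_of_lt_gap hη hlt
  have hc := mul_lt_attackC hη hlt
  have hc2 : attackC a b η ≤ (a ^ 2 + b ^ 2) / 2 := by
    unfold attackC; nlinarith
  have h1 : b ^ 2 < attackR a b η ^ 2 := by rw [hR]; nlinarith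
  have h2 : attackR a b η ^ 2 < a ^ 2 := by rw [hR]; nlinarith
  have h3 : 0 < attackR a b η ^ 2 * attackRho a b η :=
    mul_pos ((sq_nonneg b).trans_lt h1) hρ
  refine ⟨?_, ?_, ?_⟩ <;> nlinarith

theorem smallBudget_forall (hk : 1 ≤ k) (hkd : k < d) (hkn : k < n) (h : IsFullSVD X U V)
    (hη : 0 ≤ η) (hlt : η < (singVal X (k - 1) - singVal X k) / √2) {ε : ℝ} (hε : ε = 1 ∨ ε = -1)
    {Q : Submodule ℝ (EuclideanSpace ℝ (Fin d))}
    (hQ : IsPCASubspace k (X + U * embedBlock d n k (scaleOffDiag ε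
      (smallBudgetBlock (singVal X (k - 1)) (singVal X k) η)) * Vᵀ) Q) :
    IsAsimovDistance k (leadingColumnSpan k U) Q
      (attackTheta (singVal X (k - 1)) (singVal X k) η) := by
  obtain ⟨w, hw⟩ := exists_orthonormalBasis_columns h.left_orthogonal
  have hε2 : ε ^ 2 = 1 := by rcases hε with rfl | rfl <;> norm_num
  set Y := X + U * embedBlock d n k (scaleOffDiag ε
    (smallBudgetBlock (singVal X (k - 1)) (singVal X k) η)) * Vᵀ with hY
  obtain ⟨-, -, e2⟩ := perturbed_apply hk hkd hkn h hw _ hY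
  have hQfin := hQ.finrank_eq hkd.le
  have hb := singVal_nonneg X k
  set a := singVal X (k - 1) with ha'
  set b := singVal X k with hb'
  set C := (attackP11 a b η + attackP21 a b η) / √2 with hC
  set S := (attackP21 a b η - attackP11 a b η) / √2 with hS
  have hCS : C ^ 2 + S ^ 2 = 1 := by
    rw [hC, hS, div_pow, div_pow, Real.sq_sqrt zero_le_two]
    linear_combination attackP_sq_add_sq hb hη hlt
  have hC0 : 0 ≤ C :=
    div_nonneg (add_pos attackP11_pos (attackP21_pos hb hη hlt)).le (Real.sqrt_nonneg _)
  obtain ⟨eq, eq'⟩ := smallBudget_apply hk hkd hkn h hη hlt hε2 hw ha' hb' hY hC hS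
  obtain ⟨o1, o2, o3⟩ := smallBudget_eigenvalues hb hη hlt
  have hθ := arccos_eq_attackTheta hb hη hlt
  rw [← hC] at hθ
  set i₀ : Fin d := ⟨k - 1, by omega⟩ with hi₀
  set i₁ : Fin d := ⟨k, hkd⟩ with hi₁
  have h01 : i₀ ≠ i₁ := by simp only [hi₀, hi₁, ne_eq, Fin.mk.injEq]; omega
  set q := C • w i₀ + (ε * S) • w i₁ with hq
  set q' := (-(ε * S)) • w i₀ + C • w i₁ with hq'
  have hnorm : ∀ x y : ℝ, ‖x • w i₀ + y • w i₁‖ ^ 2 = x ^ 2 + y ^ 2 := by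
    intro x y
    have := norm_sq_map_add_of_orthogonal (LinearMap.id : EuclideanSpace ℝ (Fin d) →ₗ[ℝ] _)
      (x := w i₀) (y := w i₁) (w.orthonormal.2 h01) x y
    simpa only [LinearMap.id_apply, w.orthonormal.1, one_pow, mul_one] using this
  have hq1 : ‖q‖ = 1 := by
    rw [← pow_left_inj₀ (norm_nonneg _) zero_le_one two_ne_zero, hq, hnorm, mul_pow, hε2, one_mul,
      hCS, one_pow]
  have hq'1 : ‖q'‖ = 1 := by
    rw [← pow_left_inj₀ (norm_nonneg _) zero_le_one two_ne_zero, hq', hnorm, neg_sq, mul_pow, hε2,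
      one_mul, add_comm, hCS, one_pow]
  have hinner : ∀ (j : Fin d) (x y : ℝ), inner ℝ (w j) (x • w i₀ + y • w i₁) =
      (if j = i₀ then x else 0) + if j = i₁ then y else 0 := by
    intro j x y
    rw [inner_add_right, real_inner_smul_right, real_inner_smul_right,
      orthonormal_iff_ite.1 w.orthonormal, orthonormal_iff_ite.1 w.orthonormal]
    simp
  -- the eigenvectors with the `d - k` smallest eigenvalues
  let j₁ : {i : Fin d // k ≤ (i : ℕ)} := ⟨i₁, le_rfl⟩
  have hne₀ : ∀ j : {i : Fin d // k ≤ (i : ℕ)}, (j : Fin d) ≠ i₀ := fun j hj => by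
    have h1 := j.2
    rw [hj, hi₀] at h1
    simp only at h1
    omega
  have hfon : Orthonormal ℝ
      (Function.update (fun j : {i : Fin d // k ≤ (i : ℕ)} => w j) j₁ q') := by
    refine orthonormal_update (w.orthonormal.comp _ Subtype.val_injective) j₁ hq'1 fun j hj => ?_
    rw [Function.comp_apply, hq', hinner, if_neg (hne₀ j),
      if_neg fun h' => hj (Subtype.ext h'), add_zero]
  have hmem : ∀ {x : EuclideanSpace ℝ (Fin d)} {τ : ℝ}, Matrix.toEuclideanLin (Y * Yᵀ) x = τ • x →
      b ^ 2 < τ → attackR a b η ^ 2 * (1 - attackRho a b η) < τ → x ∈ Q := by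
    intro x τ hx h1 h2
    obtain ⟨w₂, μ, hμ, hw₂, rfl⟩ := hQ
    refine mem_span_leading_of_eigenvalue_gt (isSymmetric_mul_transpose Y) w₂ hμ hw₂ hx
      (β := Function.update (fun j : {i : Fin d // k ≤ (i : ℕ)} => singVal X (j : Fin d) ^ 2) j₁
        (attackR a b η ^ 2 * (1 - attackRho a b η))) hfon ?_ ?_
    · intro j
      by_cases hj : j = j₁
      · subst hj
        simp only [Function.update_self]
        exact eq'
      · rw [Function.update_of_ne hj, Function.update_of_ne hj]
        exact e2 j (fun h' => hne₀ j (Fin.ext h')) fun h' => hj (Subtype.ext (Fin.ext h'))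
    · intro j
      by_cases hj : j = j₁
      · subst hj
        rw [Function.update_self]
        exact h2
      · rw [Function.update_of_ne hj]
        exact (pow_le_pow_left₀ (singVal_nonneg X _) (singVal_antitone X j.2) 2).trans_lt h1
  set u : Fin k → EuclideanSpace ℝ (Fin d) := fun i => w (Fin.castLE hkd.le i) with hu
  set l : Fin k := ⟨k - 1, by omega⟩ with hl
  have huon : Orthonormal ℝ u := w.orthonormal.comp _ (Fin.castLE_injective hkd.le)
  have hul : u l = w i₀ := rfl
  have hvon : Orthonormal ℝ (Function.update u l q) := by
    refine orthonormal_update huon l hq1 fun j hj => ?_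
    have h1 : Fin.castLE hkd.le j ≠ i₀ := fun h' => by
      have h3 : (j : ℕ) = k - 1 := congrArg Fin.val h'
      exact hj (Fin.ext h3)
    have h2 : Fin.castLE hkd.le j ≠ i₁ := fun h' => by
      have h3 : (j : ℕ) = k := congrArg Fin.val h'
      have := j.2
      omega
    rw [hq, hu, hinner, if_neg h1, if_neg h2, add_zero]
  have hqQ : Submodule.span ℝ (Set.range (Function.update u l q)) = Q := by
    refine span_range_eq_of_orthonormal hQfin hvon fun i => ?_
    by_cases hi : i = l
    · rw [hi, Function.update_self]
      exact hmem eq o3 o1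
    · rw [Function.update_of_ne hi]
      have hik := i.2
      have h1 : (i : ℕ) ≠ k - 1 := fun h' => hi (Fin.ext h')
      have h2 : a ^ 2 ≤ singVal X i ^ 2 :=
        pow_le_pow_left₀ (singVal_nonneg X _) (singVal_antitone X (by omega)) 2
      have h3 : b ^ 2 < a ^ 2 := pow_lt_pow_left₀ (lt_of_lt_gap hη hlt) hb two_ne_zero
      exact hmem (e2 (Fin.castLE hkd.le i) h1 hik.ne) (h3.trans_le h2) (o2.trans_le h2)
  have hP : Submodule.span ℝ (Set.range u) = leadingColumnSpan k U := by
    refine span_range_eq_of_orthonormal (finrank_leadingColumnSpan hkd h) huon fun i => ?_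
    rw [leadingColumnSpan_eq hw]
    exact Submodule.subset_span ⟨_, i.2, rfl⟩
  have hc : inner ℝ (u l) q = C := by
    rw [hul, hq, hinner, if_pos rfl, if_neg h01, add_zero]
  have := isAsimovDistance_update_last hk huon hvon (by rw [hc]; exact hC0)
  rwa [hqQ, hP, hc, hθ] at this

end Attack

end

theorem mainTheorem7 (d n k : ℕ) (hk : 1 ≤ k) (hkd : k < d) (hkn : k < n)
    (X : Matrix (Fin d) (Fin n) ℝ) (hrank : k ≤ X.rank) (η : ℝ) (hη : 0 ≤ η) :
    -- the optimal value, for every PCA subspace `P` of `X`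
    (∀ P, IsPCASubspace k X P →
      ((singVal X (k - 1) - singVal X k) / √2 ≤ η →
        IsGreatest (attackValues k X P η) (Real.pi / 2)) ∧
      (η < (singVal X (k - 1) - singVal X k) / √2 →
        IsGreatest (attackValues k X P η)
          (attackTheta (singVal X (k - 1)) (singVal X k) η))) ∧
    -- explicit maximizers `ΔX = U B Vᵀ`, for every full SVD `X = U Σ Vᵀ`
    (∀ U V, IsFullSVD X U V →
      IsPCASubspace k X (leadingColumnSpan k U) ∧
      ((singVal X (k - 1) - singVal X k) / √2 ≤ η →
        ‖U * embedBlock d n k (largeBudgetBlock η) * Vᵀ‖ ≤ η ∧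
        (∃ Q, IsPCASubspace k (X + U * embedBlock d n k (largeBudgetBlock η) * Vᵀ) Q ∧
          IsAsimovDistance k (leadingColumnSpan k U) Q (Real.pi / 2)) ∧
        ((singVal X (k - 1) - singVal X k) / √2 < η →
          ∀ Q, IsPCASubspace k (X + U * embedBlock d n k (largeBudgetBlock η) * Vᵀ) Q →
            IsAsimovDistance k (leadingColumnSpan k U) Q (Real.pi / 2))) ∧
      (η < (singVal X (k - 1) - singVal X k) / √2 →
        ∀ ε : ℝ, ε = 1 ∨ ε = -1 →
          ∀ ΔX, ΔX = U * embedBlock d n k (scaleOffDiag ε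
              (smallBudgetBlock (singVal X (k - 1)) (singVal X k) η)) * Vᵀ →
            ‖ΔX‖ ≤ η ∧ (∃ Q, IsPCASubspace k (X + ΔX) Q) ∧
            ∀ Q, IsPCASubspace k (X + ΔX) Q →
              IsAsimovDistance k (leadingColumnSpan k U) Q
                (attackTheta (singVal X (k - 1)) (singVal X k) η))) := by
  have ha : 0 < singVal X (k - 1) := singVal_pos_of_lt_rank X (by omega)
  refine ⟨fun P hP => ?_, fun U V h => ⟨isPCASubspace_leadingColumnSpan hk hkd hkn h,
    fun hle => ⟨largeBudget_norm_le hk hkd hkn h hη, largeBudget_exists hk hkd hkn h ha hle,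
      fun hlt Q hQ => largeBudget_forall hk hkd hkn h ha hlt hQ⟩, ?_⟩⟩
  · obtain ⟨U, V, h, rfl⟩ := hP.exists_isFullSVD
    refine ⟨fun hle => ⟨?_, ?_⟩, fun hlt => ⟨?_, ?_⟩⟩
    · obtain ⟨Q, hQ, hθ⟩ := largeBudget_exists hk hkd hkn h ha hle
      exact ⟨_, Q, largeBudget_norm_le hk hkd hkn h hη, hQ, hθ⟩
    · rintro θ ⟨D, Q, -, -, hθ⟩
      exact hθ.le_pi_div_two
    · obtain ⟨Q, hQ⟩ := exists_isPCASubspace k (X + U * embedBlock d n k (scaleOffDiag 1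
        (smallBudgetBlock (singVal X (k - 1)) (singVal X k) η)) * Vᵀ)
      exact ⟨_, Q, smallBudget_norm_le hk hkd hkn h hη hlt (Or.inl rfl), hQ,
        smallBudget_forall hk hkd hkn h hη hlt (Or.inl rfl) hQ⟩
    · rintro θ ⟨D, Q, hD, hQ, hθ⟩
      exact le_attackTheta hk hkd hkn h hη hlt hD hQ hθ
  · rintro hlt ε hε D rfl
    exact ⟨smallBudget_norm_le hk hkd hkn h hη hlt hε, exists_isPCASubspace k _,
      fun Q hQ => smallBudget_forall hk hkd hkn h hη hlt hε hQ⟩
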